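/- **Setting.** Let $g:\mathbb R^d\to\mathbb R^d$, $h(x)=x-g(x)$, and let $h(x^*)=0$. Assume that $h$ is Lipschitz continuously differentiable near $x^*$, that $h'(x^*)$ is positive definite, and that $g'(x)$ is symmetric for all $x$ near $x^*$. Let $\hat\rho,\hat\kappa,\mu,L>0$ be constants such that $h$ is differentiable on $\{\|x-x^*\|_2\le\hat\rho\}$ and for all $x$ in this ball and all $y$: $\mu\|y\|_2\le\|h'(x)y\|_2\le L\|y\|_2$, $\ \mu\|y\|_2^2\le y^{\rm T}h'(x)y\le L\|y\|_2^2$, $\ \|h(x)-h'(x^*)(x-x^*)\|_2\le\frac12\hat\kappa\|x-x^*\|_2^2$. Put $A:=h'(x^*)$, $r_k:=-h(x_k)$, $\Delta x_k:=x_{k+1}-x_k$, $\Delta r_k:=r_{k+1}-r_k$. **Process I (restarted ST-AM).** Parameters: $m\ge1$, $\tau\in(0,1)$, $\eta>0$, and mixing parameters with $\beta\le|\beta_k|\le\beta'$, where $\beta,\beta'>0$. Let $v_j:=p_j$ (Type-I) or $v_j:=q_j$ (Type-II). Iteration $k$ is entered with $m_0=0$, respectively $m_k=m_{k-1}+1$.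 * If $m_k>m$ or $\|r_k\|_2>\eta\|r_{k-m_k}\|_2$, set $m_k=0$. * If $m_k>0$, start from $p_k=\Delta x_{k-1}$, $q_k=\Delta r_{k-1}$, and for $j=\max\{1,m_k-2\},\dots,m_k-1$ (in this order) put $\zeta_k^{(j)}=\frac{v_{k-m_k+j}^{\rm T}q_k}{v_{k-m_k+j}^{\rm T}q_{k-m_k+j}}$ and replace $p_k,q_k$ by $p_k-\zeta_k^{(j)}p_{k-m_k+j}$, $q_k-\zeta_k^{(j)}q_{k-m_k+j}$. Then, if $|v_k^{\rm T}q_k|<\tau|v_{k-m_k+1}^{\rm T}q_{k-m_k+1}|$, set $m_k=0$. * Start from $\bar x_k=x_k$, $\bar r_k=r_k$, and for $j=\max\{1,m_k-1\},\dots,m_k$ put $\Gamma_k^{(j)}=\frac{v_{k-m_k+j}^{\rm T}\bar r_k}{v_{k-m_k+j}^{\rm T}q_{k-m_k+j}}$ and replace $\bar x_k,\bar r_k$ by $\bar x_k-\Gamma_k^{(j)}p_{k-m_k+j}$, $\bar r_k-\Gamma_k^{(j)}q_{k-m_k+j}$. Set $x_{k+1}=\bar x_k+\beta_k\bar r_k$.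 Below, $m_k$ is the final value at iteration $k$. **Process II (linearized process).** With the same $m_k,\beta_k$ and type as in Process I, put $\hat r_k=-A(\hat x_k-x^*)$; let $\hat x_k=x_k$ whenever $m_k=0$, and in each cycle between restarts $$\hat x_{k+1}=\hat x_k+\beta_k\hat r_k-(\hat P_k+\beta_k\hat Q_k)\hat\Gamma_k,\qquad \hat r_k-\hat Q_k\hat\Gamma_k\perp{\rm range}(\hat V_k),$$ where $\hat P_k=(\hat p_{k-m_k+1},\dots,\hat p_k)$, $\hat Q_k=(\hat q_{k-m_k+1},\dots,\hat q_k)$, $\hat V_k=\hat P_k$ (Type-I) or $\hat Q_k$ (Type-II), the terms with $\hat P_k,\hat Q_k$ being absent if $m_k=0$. For $m_k\ge1$, $\hat p_k=\Delta\hat x_{k-1}-\hat P_{k-1}\hat\zeta_k$, $\hat q_k=\Delta\hat r_{k-1}-\hat Q_{k-1}\hat\zeta_k$ with $\hat\zeta_k$ such that $\hat q_k\perp{\rm range}(\hat V_{k-1})$ (no $\hat\zeta_k$ term if $m_k=1$). **Tridiagonal matrices.** Let $\phi_i:=\Gamma_i^{(m_i)}+\zeta_{i+1}^{(m_i)}$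 if $m_i\ge1$ and $\phi_i:=0$ if $m_i=0$. For $m_{k+1}\ge2$, $T_k\in\mathbb R^{m_k\times m_k}$ is the tridiagonal matrix whose column number $m_i=i-(k-m_k)$, for $i=k-m_k+1,\dots,k$, has the entries $$\frac{\phi_{i-1}}{\beta_{i-1}(1-\Gamma_i^{(m_i)})},\qquad \frac1{1-\Gamma_i^{(m_i)}}\Bigl(\frac1{\beta_{i-1}}-\frac{\phi_i}{\beta_i}\Bigr),\qquad -\frac1{\beta_i(1-\Gamma_i^{(m_i)})}$$ above, on and below the diagonal (entries outside the matrix are dropped). $\hat T_k$ is defined in the same way from $\hat\Gamma,\hat\zeta$. **Theorem.** Let $\eta_0,\tau_0>0$. There is a constant $C>0$, depending only on $d$, the type, $m,\tau,\eta,\beta,\beta',\eta_0,\tau_0,\mu,L$, and for all $\hat\rho,\hat\kappa$ there is a $\delta>0$, depending only on these data and $\hat\rho,\hat\kappa$, such that the following holds whenever $\|x_0-x^*\|_2\le\delta$. Let $k$ be such that $m_{k+1}\ge2$, the cycle of $k$ was not started at an exact solution ($r_{k-m_k}\ne0$), $\|h(x_j)\|_2\le\eta_0\|h(x_0)\|_2$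 for $0\le j\le k+1$, and $|1-\Gamma_j^{(m_j)}|\ge\tau_0$ for all $1\le j\le k$ with $m_j\ge1$. Then: 1. Every eigenvalue $\lambda\in\mathbb C$ of $T_k$ satisfies $$\min_{\hat\lambda\in\sigma(\hat T_k)}|\hat\lambda-\lambda|\le\hat\kappa\,C\,\|x_{k-m_k}-x^*\|_2 .$$ 2. $\hat T_k$ is a generalized Lanczos matrix of $A$: with $B=A$ for Type-I and $B=A^2$ for Type-II, the first $j$ columns of $\hat P_k$ span the Krylov subspace ${\rm span}\{\hat r_{k-m_k},A\hat r_{k-m_k},\dots,A^{j-1}\hat r_{k-m_k}\}$ for $1\le j\le m_k$, the matrix $\hat P_k^{\rm T}B\hat P_k$ is diagonal with positive diagonal, and $\hat P_k^{\rm T}BA\hat P_k=\hat P_k^{\rm T}B\hat P_k\,\hat T_k$; so the eigenvalues of $\hat T_k$ are generalized Ritz values of $A$. -/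

import Mathlib

open Filter Topology

/-- The two variants of Anderson mixing. -/
inductive AMType where
  | typeI
  | typeII

/-- The test directions `v_j`: `v_j = p_j` for Type-I and `v_j = q_j` for Type-II. -/
def AMType.dir {E : Type*} (t : AMType) (p q : ℕ → E) : ℕ → E :=
  match t with
  | .typeI => p
  | .typeII => q

/-- `h(x) = x - g(x)`; the residual of the fixed-point problem at `x` is `-h(x) = g(x) - x`. -/
def fpDefect {d : ℕ} (g : EuclideanSpace ℝ (Fin d) → EuclideanSpace ℝ (Fin d)) :
    EuclideanSpace ℝ (Fin d) → EuclideanSpace ℝ (Fin d) :=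
  fun x => x - g x

/-- The standing assumption on the fixed-point problem: `x*` is a zero of `h = id - g`, `h` is
Lipschitz continuously differentiable near `x*`, and `h'(x*)` is positive definite (its symmetric
part has only positive eigenvalues). -/
structure RegularFixedPoint {d : ℕ}
    (g : EuclideanSpace ℝ (Fin d) → EuclideanSpace ℝ (Fin d))
    (xs : EuclideanSpace ℝ (Fin d)) : Prop where
  zero : fpDefect g xs = 0
  lipschitz_C1 : ∃ U ∈ 𝓝 xs, ∃ K : NNReal, (∀ x ∈ U, DifferentiableAt ℝ (fpDefect g) x) ∧
    LipschitzOnWith K (fderiv ℝ (fpDefect g)) U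
  posDef : ∀ y, y ≠ 0 → 0 < inner ℝ y (fderiv ℝ (fpDefect g) xs y)

/-- `ρ, κ, μ, L` are admissible local constants of `h` on the closed ball of radius `ρ`
about `x*`. -/
structure LocalConstants {d : ℕ}
    (h : EuclideanSpace ℝ (Fin d) → EuclideanSpace ℝ (Fin d))
    (xs : EuclideanSpace ℝ (Fin d)) (ρ κ μ L : ℝ) : Prop where
  differentiable : ∀ x ∈ Metric.closedBall xs ρ, DifferentiableAt ℝ h x
  jacobian : ∀ x ∈ Metric.closedBall xs ρ, ∀ y,
    μ * ‖y‖ ≤ ‖fderiv ℝ h x y‖ ∧ ‖fderiv ℝ h x y‖ ≤ L * ‖y‖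
  form : ∀ x ∈ Metric.closedBall xs ρ, ∀ y,
    μ * ‖y‖ ^ 2 ≤ inner ℝ y (fderiv ℝ h x y) ∧ inner ℝ y (fderiv ℝ h x y) ≤ L * ‖y‖ ^ 2
  linearization : ∀ x ∈ Metric.closedBall xs ρ,
    ‖h x - fderiv ℝ h xs (x - xs)‖ ≤ 1 / 2 * κ * ‖x - xs‖ ^ 2

section Sweep

variable {E : Type*} [NormedAddCommGroup E] [InnerProductSpace ℝ E]

/-- Modified Gram–Schmidt sweep: starting from `w`, the steps `j = lo, lo + 1, …` (with `j ≥ 1`)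
subtract the multiple of `q (s + j)` that makes the result orthogonal to `v (s + j)`.
`gsSweep v q s lo w j` is the vector after step `j`. -/
noncomputable def gsSweep (v q : ℕ → E) (s lo : ℕ) (w : E) : ℕ → E
  | 0 => w
  | j + 1 =>
    if lo ≤ j + 1 then
      gsSweep v q s lo w j -
        (inner ℝ (v (s + (j + 1))) (gsSweep v q s lo w j) /
          inner ℝ (v (s + (j + 1))) (q (s + (j + 1)))) • q (s + (j + 1))
    else gsSweep v q s lo w j

/-- The coefficient used in step `j` of the sweep (zero for skipped steps). -/
noncomputable def gsCoeff (v q : ℕ → E) (s lo : ℕ) (w : E) : ℕ → ℝ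
  | 0 => 0
  | j + 1 =>
    if lo ≤ j + 1 then
      inner ℝ (v (s + (j + 1))) (gsSweep v q s lo w j) /
        inner ℝ (v (s + (j + 1))) (q (s + (j + 1)))
    else 0

end Sweep

/-- The memory size `m_k` with which iteration `k` is entered, before the restarting conditions
are tested: `0` for `k = 0`, and otherwise one more than the final memory size of the preceding
iteration. -/
def enterMem (n : ℕ → ℕ) : ℕ → ℕ
  | 0 => 0
  | k + 1 => n k + 1

section STAM

variable {d : ℕ}

/-- The coefficient `ζ_k^{(j)}` of restarted ST-AM: the sweep runs over
`j = max{1, m_k - 2}, …, m_k - 1`, starting from `Δr_{k-1}`. -/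
noncomputable def stamZeta (t : AMType)
    (g : EuclideanSpace ℝ (Fin d) → EuclideanSpace ℝ (Fin d))
    (x p q : ℕ → EuclideanSpace ℝ (Fin d)) (n : ℕ → ℕ) (k j : ℕ) : ℝ :=
  gsCoeff (t.dir p q) q (k - enterMem n k) (max 1 (enterMem n k - 2))
    ((g (x k) - x k) - (g (x (k - 1)) - x (k - 1))) j

/-- The coefficient `Γ_k^{(j)}` of restarted ST-AM: the sweep runs over
`j = max{1, m_k - 1}, …, m_k`, starting from `r_k`. -/
noncomputable def stamGamma (t : AMType)
    (g : EuclideanSpace ℝ (Fin d) → EuclideanSpace ℝ (Fin d))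
    (x p q : ℕ → EuclideanSpace ℝ (Fin d)) (n : ℕ → ℕ) (k j : ℕ) : ℝ :=
  gsCoeff (t.dir p q) q (k - n k) (max 1 (n k - 1)) (g (x k) - x k) j

/-- The first restarting test at iteration `k`: the memory exceeds `m`, or the residual has grown
by more than the factor `η` since the last restart. -/
def RestartTest (g : EuclideanSpace ℝ (Fin d) → EuclideanSpace ℝ (Fin d)) (m : ℕ) (η : ℝ)
    (x : ℕ → EuclideanSpace ℝ (Fin d)) (n : ℕ → ℕ) (k : ℕ) : Prop :=
  m < enterMem n k ∨
    η * ‖g (x (k - enterMem n k)) - x (k - enterMem n k)‖ < ‖g (x k) - x k‖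

/-- The second restarting test at iteration `k`: `|v_kᵀ q_k| < τ |v_{k-m_k+1}ᵀ q_{k-m_k+1}|`. -/
def CurvatureTest (t : AMType) (τ : ℝ) (p q : ℕ → EuclideanSpace ℝ (Fin d))
    (n : ℕ → ℕ) (k : ℕ) : Prop :=
  |inner ℝ (t.dir p q k) (q k)| <
    τ * |inner ℝ (t.dir p q (k - enterMem n k + 1)) (q (k - enterMem n k + 1))|

open Classical in
/-- The sequences `x`, `p`, `q` and the (final) memory sizes `n k = m_k` are those of a run of the
restarted Type-I/Type-II ST-AM method for the fixed-point map `g` with mixing parameters `β`,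
maximal memory `m` and restart parameters `τ`, `η`. -/
structure IsRestartedSTAM (t : AMType)
    (g : EuclideanSpace ℝ (Fin d) → EuclideanSpace ℝ (Fin d))
    (β : ℕ → ℝ) (m : ℕ) (τ η : ℝ)
    (x p q : ℕ → EuclideanSpace ℝ (Fin d)) (n : ℕ → ℕ) : Prop where
  pair_p : ∀ k, 0 < enterMem n k → ¬ RestartTest g m η x n k →
    p k = (x k - x (k - 1)) -
      ∑ j ∈ Finset.Icc 1 (enterMem n k - 1), stamZeta t g x p q n k j • p (k - enterMem n k + j)
  pair_q : ∀ k, 0 < enterMem n k → ¬ RestartTest g m η x n k →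
    q k = ((g (x k) - x k) - (g (x (k - 1)) - x (k - 1))) -
      ∑ j ∈ Finset.Icc 1 (enterMem n k - 1), stamZeta t g x p q n k j • q (k - enterMem n k + j)
  mem : ∀ k, n k =
    if RestartTest g m η x n k then 0
    else if 0 < enterMem n k ∧ CurvatureTest t τ p q n k then 0
    else enterMem n k
  update : ∀ k, x (k + 1) =
    (x k - ∑ j ∈ Finset.Icc 1 (n k), stamGamma t g x p q n k j • p (k - n k + j)) +
      β k • ((g (x k) - x k) -
        ∑ j ∈ Finset.Icc 1 (n k), stamGamma t g x p q n k j • q (k - n k + j))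

/-- The linearized process. Between two successive restarts of a given run (iterates `x`, memory
sizes `n`), full-memory Type-I/Type-II Anderson mixing with modified historical sequences is
applied to `A (y - x*) = 0`, started from the iterate of the run at the restart. The hatted
sequences are `y = x̂`, `p = p̂`, `q = q̂`, `ζ = ζ̂`, `Γ = Γ̂`; the residuals are
`r̂_k = -A (x̂_k - x*)`. Here `ζ̂_k` and `Γ̂_k` are determined by orthogonality to all test
directions of the current cycle. -/
structure IsLinearizedAM (t : AMType)
    (A : EuclideanSpace ℝ (Fin d) →L[ℝ] EuclideanSpace ℝ (Fin d))
    (xs : EuclideanSpace ℝ (Fin d)) (β : ℕ → ℝ)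
    (x : ℕ → EuclideanSpace ℝ (Fin d)) (n : ℕ → ℕ)
    (y p q : ℕ → EuclideanSpace ℝ (Fin d)) (ζ Γ : ℕ → ℕ → ℝ) : Prop where
  restart : ∀ k, n k = 0 → y k = x k
  pair_p : ∀ k, n k ≠ 0 →
    p k = (y k - y (k - 1)) - ∑ j ∈ Finset.Icc 1 (n k - 1), ζ k j • p (k - n k + j)
  pair_q : ∀ k, n k ≠ 0 →
    q k = (-A (y k - xs) - -A (y (k - 1) - xs)) -
      ∑ j ∈ Finset.Icc 1 (n k - 1), ζ k j • q (k - n k + j)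
  pair_orth : ∀ k, n k ≠ 0 → ∀ i ∈ Finset.Icc 1 (n k - 1),
    inner ℝ (t.dir p q (k - n k + i)) (q k) = 0
  mix_orth : ∀ k, ∀ i ∈ Finset.Icc 1 (n k),
    inner ℝ (t.dir p q (k - n k + i))
      (-A (y k - xs) - ∑ j ∈ Finset.Icc 1 (n k), Γ k j • q (k - n k + j)) = 0
  update : ∀ k, n (k + 1) ≠ 0 → y (k + 1) =
    y k + β k • (-A (y k - xs)) -
      ∑ j ∈ Finset.Icc 1 (n k), Γ k j • (p (k - n k + j) + β k • q (k - n k + j))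

/-- `φ_k = Γ_k^{(m_k)} + ζ_{k+1}^{(m_k)}`, and `φ_k = 0` if `m_k = 0`. -/
noncomputable def amPhi (n : ℕ → ℕ) (ζ Γ : ℕ → ℕ → ℝ) (k : ℕ) : ℝ :=
  if n k = 0 then 0 else Γ k (n k) + ζ (k + 1) (n k)

/-- The tridiagonal `m_k × m_k` matrix `T_k`. Its column `b` (counted from `0`) belongs to the
iteration `i = k - m_k + 1 + b` and holds `t_i^{(m_i - 1)}`, `t_i^{(m_i)}`, `t_i^{(m_i + 1)}` above,
on and below the diagonal. -/
noncomputable def amTridiag (β : ℕ → ℝ) (n : ℕ → ℕ) (ζ Γ : ℕ → ℕ → ℝ) (k : ℕ) :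
    Matrix (Fin (n k)) (Fin (n k)) ℝ :=
  Matrix.of fun a b =>
    let i := k - n k + 1 + (b : ℕ)
    if (a : ℕ) + 1 = b then amPhi n ζ Γ (i - 1) / (β (i - 1) * (1 - Γ i (n i)))
    else if (a : ℕ) = b then
      1 / (1 - Γ i (n i)) * (1 / β (i - 1) - amPhi n ζ Γ i / β i)
    else if (a : ℕ) = b + 1 then -(1 / (β i * (1 - Γ i (n i))))
    else 0

/-- The Krylov subspace `span{r, A r, …, A^{j-1} r}`. -/
def krylov (A : EuclideanSpace ℝ (Fin d) →L[ℝ] EuclideanSpace ℝ (Fin d))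
    (r : EuclideanSpace ℝ (Fin d)) (j : ℕ) : Submodule ℝ (EuclideanSpace ℝ (Fin d)) :=
  Submodule.span ℝ (Set.range fun i : Fin j => (A ^ (i : ℕ)) r)

/-- The operator whose inner product the Lanczos method uses: `A` for Type-I, `A²` for Type-II. -/
noncomputable def AMType.weight (t : AMType)
    (A : EuclideanSpace ℝ (Fin d) →L[ℝ] EuclideanSpace ℝ (Fin d)) :
    EuclideanSpace ℝ (Fin d) →L[ℝ] EuclideanSpace ℝ (Fin d) :=
  match t with
  | .typeI => A
  | .typeII => A ^ 2

/-- `T` is the Lanczos matrix of `A` in the `B`-inner product `⟨u, B v⟩` for the starting vector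
`r` and the basis `w`: `w` is a `B`-orthogonal basis adapted to the Krylov subspaces generated by
`r`, and `T` is the matrix in this basis of the `B`-orthogonal projection of `A` to their largest
one. The eigenvalues of such a matrix are the generalized Ritz values of `A`. -/
structure IsLanczosMatrix
    (B A : EuclideanSpace ℝ (Fin d) →L[ℝ] EuclideanSpace ℝ (Fin d))
    (r : EuclideanSpace ℝ (Fin d)) {l : ℕ} (w : Fin l → EuclideanSpace ℝ (Fin d))
    (T : Matrix (Fin l) (Fin l) ℝ) : Prop where
  krylov_basis : ∀ j : Fin l, Submodule.span ℝ (w '' Set.Iic j) = krylov A r ((j : ℕ) + 1)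
  orth : ∀ i j, i ≠ j → inner ℝ (w i) (B (w j)) = 0
  pos : ∀ i, 0 < inner ℝ (w i) (B (w i))
  projection : ∀ i j,
    inner ℝ (w i) (B (A (w j))) = ∑ a, inner ℝ (w i) (B (w a)) * T a j

end STAM

/-! The linearized process is a Lanczos process in disguise, the actual run is a small perturbation
of it within each cycle, and a symmetrizable matrix has stable eigenvalues.

Linear side. Put `K = I` (Type-I) or `K = A` (Type-II), so that all orthogonality is with respect to
the symmetric form `⟨x, K A y⟩`. The minimized residuals `mixedResidual` are mutually
`K`-orthogonal, and `A P_j` is a multiple of the difference of two consecutive ones. Hence all but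
the last coefficient in the recurrence for `P_{i+1}` vanish (`LinearCycle.phi_eq_zero`). This has
two effects. It gives the three-term recurrence `LinearCycle.three_term`, whose coefficients are the
entries of the tridiagonal matrix, and with it the Lanczos property. It also shows that the
projections skipped by the truncated sweeps of the run have zero coefficients in the full-memory
linear process.

Perturbation side. Let `ε` be the error at the start of a cycle and `e = κ ε`. The curvature test
and the first step bound `|v_jᵀ q_j|` below by a multiple of `ε²` (`isBigO_curvature`). All errors
and directions are therefore `O(ε)` and all coefficients `O(1)` (`isBigO_aux`). A second induction
(`CycleRun.close`) compares with the linear process: vectors differ by `O(e ε)`, coefficients by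
`O(e)`. It also transfers nondegeneracy to the linear process, which is what makes the skipped
coefficients vanish at the next step. The entries of the two tridiagonal matrices then differ by
`O(e)`. The linear one is symmetrized by the diagonal matrix of the numbers `D_j = ⟨P_j, K A P_j⟩`,
all comparable to `ε²`, so Bauer–Fike moves eigenvalues by at most `C e = κ C ε`.

Uniformity. The estimates are Landau symbols along a filter on the type `CycleRun` of all cycles, in
which the map, the solution, `ρ` and `κ` vary. The implied constants thus depend only on the fixed
parameters. Finally, the residual bound with factor `η₀` keeps the starting point of every cycle
near the solution. -/

/-! ### Eigenvalue perturbation for symmetrizable matrices. -/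

theorem Matrix.mem_spectrum_iff_exists_mulVec {ι : Type*} [Fintype ι] [DecidableEq ι]
    (M : Matrix ι ι ℂ) (lam : ℂ) :
    lam ∈ spectrum ℂ M ↔ ∃ v : ι → ℂ, v ≠ 0 ∧ M.mulVec v = lam • v := by
  rw [spectrum.mem_iff, Matrix.isUnit_iff_isUnit_det, isUnit_iff_ne_zero, not_not,
    ← Matrix.exists_mulVec_eq_zero_iff]
  refine exists_congr fun v => and_congr_right fun _ => ?_
  rw [Matrix.sub_mulVec, sub_eq_zero, Matrix.algebraMap_eq_diagonal, eq_comm]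
  have : (Matrix.diagonal ((algebraMap ℂ (ι → ℂ)) lam)).mulVec v = lam • v := by
    ext i
    simp [Matrix.mulVec_diagonal]
  rw [this]

/-- A Hermitian matrix has an eigenvalue within `c` of `lam` if it has a `c`-approximate
eigenvector for `lam`. -/
theorem Matrix.IsHermitian.exists_eigenvalue_near {ι : Type*} [Fintype ι] [DecidableEq ι]
    {S : Matrix ι ι ℂ} (hS : S.IsHermitian) (lam : ℂ) (c : ℝ) (w : EuclideanSpace ℂ ι)
    (hw : w ≠ 0)
    (h : ‖(WithLp.toLp 2 (S.mulVec w.ofLp - lam • w.ofLp) : EuclideanSpace ℂ ι)‖ ≤ c * ‖w‖) :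
    ∃ lam' : ℂ, ‖lam' - lam‖ ≤ c ∧ ∃ u : ι → ℂ, u ≠ 0 ∧ S.mulVec u = lam' • u := by
  by_contra! hcon
  have hfar : ∀ i, c < ‖((hS.eigenvalues i : ℝ) : ℂ) - lam‖ := by
    intro i
    by_contra! hi
    refine hcon _ hi (hS.eigenvectorBasis i).ofLp ?_ ?_
    · intro h0
      have := hS.eigenvectorBasis.orthonormal.ne_zero i
      exact this (by ext j; simp [h0])
    · rw [hS.mulVec_eigenvectorBasis]
      ext j
      simp
  set e : EuclideanSpace ℂ ι := WithLp.toLp 2 (S.mulVec w.ofLp - lam • w.ofLp) with he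
  have hc : 0 ≤ c := by
    by_contra! hc
    have : 0 < ‖w‖ := norm_pos_iff.2 hw
    nlinarith [norm_nonneg e]
  have hcoef : ∀ i, inner ℂ (hS.eigenvectorBasis i) e
      = (((hS.eigenvalues i : ℝ) : ℂ) - lam) * inner ℂ (hS.eigenvectorBasis i) w := by
    intro i
    have h1 : inner ℂ (hS.eigenvectorBasis i) e =
        (S.mulVec w.ofLp - lam • w.ofLp) ⬝ᵥ star (hS.eigenvectorBasis i).ofLp := by
      rw [EuclideanSpace.inner_eq_star_dotProduct]
    have h2 : inner ℂ (hS.eigenvectorBasis i) w =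
        w.ofLp ⬝ᵥ star (hS.eigenvectorBasis i).ofLp := by
      rw [EuclideanSpace.inner_eq_star_dotProduct]
    have h3 : S.mulVec w.ofLp ⬝ᵥ star (hS.eigenvectorBasis i).ofLp =
        ((hS.eigenvalues i : ℝ) : ℂ) * (w.ofLp ⬝ᵥ star (hS.eigenvectorBasis i).ofLp) := by
      have h4 : star (S.mulVec (hS.eigenvectorBasis i).ofLp) =
          ((hS.eigenvalues i : ℝ) : ℂ) • star (hS.eigenvectorBasis i).ofLp := by
        rw [hS.mulVec_eigenvectorBasis]
        ext j
        simp
      rw [Matrix.star_mulVec, hS.eq] at h4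
      rw [dotProduct_comm, Matrix.dotProduct_mulVec, h4, smul_dotProduct, dotProduct_comm,
        smul_eq_mul]
    rw [h1, h2, sub_dotProduct, h3, smul_dotProduct, smul_eq_mul]
    ring
  have hsum : ∀ y : EuclideanSpace ℂ ι,
      ‖y‖ ^ 2 = ∑ i, ‖inner ℂ (hS.eigenvectorBasis i) y‖ ^ 2 := fun y =>
    (hS.eigenvectorBasis.sum_sq_norm_inner_right y).symm
  -- Parseval in the eigenbasis: each coefficient of `w` is multiplied by a number of modulus
  -- greater than `c`, and at least one coefficient is nonzero.
  have hlt : (c * ‖w‖) ^ 2 < ‖e‖ ^ 2 := by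
    rw [mul_pow, hsum w, hsum e, Finset.mul_sum]
    have hex : ∃ i, inner ℂ (hS.eigenvectorBasis i) w ≠ 0 := by
      by_contra! h0
      have := hsum w
      simp only [h0, norm_zero] at this
      simp at this
      exact hw this
    obtain ⟨i, hi⟩ := hex
    refine Finset.sum_lt_sum (fun j _ => ?_) ⟨i, Finset.mem_univ i, ?_⟩
    · rw [hcoef, norm_mul, mul_pow]
      have := (hfar j).le
      gcongr
    · rw [hcoef, norm_mul, mul_pow]
      have := hfar i
      have h5 : 0 < ‖inner ℂ (hS.eigenvectorBasis i) w‖ := norm_pos_iff.2 hi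
      gcongr
  have : ‖e‖ ^ 2 ≤ (c * ‖w‖) ^ 2 := by gcongr
  linarith

/-- Bauer–Fike theorem for a real matrix `T'` that is symmetrized by a positive diagonal
matrix `D`. -/
theorem Matrix.exists_spectrum_near {ι : Type*} [Fintype ι] [DecidableEq ι]
    (T T' : Matrix ι ι ℝ) (D : ι → ℝ) (hD : ∀ i, 0 < D i)
    (hsym : ∀ i j, D i * T' i j = D j * T' j i) (c : ℝ)
    (hc : ∑ i, ∑ j, √(D i / D j) * |T i j - T' i j| ≤ c) (lam : ℂ)
    (hlam : lam ∈ spectrum ℂ (T.map (algebraMap ℝ ℂ))) :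
    ∃ lam' ∈ spectrum ℂ (T'.map (algebraMap ℝ ℂ)), ‖lam' - lam‖ ≤ c := by
  obtain ⟨v, hv, hTv⟩ := (Matrix.mem_spectrum_iff_exists_mulVec _ _).1 hlam
  have hs : ∀ i, 0 < √(D i) := fun i => Real.sqrt_pos.2 (hD i)
  have hsC : ∀ i, ((√(D i) : ℝ) : ℂ) ≠ 0 := fun i => by exact_mod_cast (hs i).ne'
  have hss : ∀ i, √(D i) * √(D i) = D i := fun i => Real.mul_self_sqrt (hD i).le
  -- `S` is the conjugate of `T'` by the square root of `D`; `hsym` says exactly that it is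
  -- Hermitian. The conjugated eigenvector `w` of `T` is an approximate eigenvector of `S`.
  let S : Matrix ι ι ℂ := Matrix.of fun i j => ((√(D i) * T' i j / √(D j) : ℝ) : ℂ)
  have hS : S.IsHermitian := by
    ext i j
    simp only [S, Matrix.conjTranspose_apply, Matrix.of_apply, RCLike.star_def, Complex.conj_ofReal]
    congr 1
    rw [div_eq_div_iff (hs i).ne' (hs j).ne']
    have := hsym i j
    rw [← hss i, ← hss j] at this
    linarith
  let w : EuclideanSpace ℂ ι := WithLp.toLp 2 fun i => ((√(D i) : ℝ) : ℂ) * v i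
  have hw : w ≠ 0 := by
    intro h0
    apply hv
    ext i
    have : w i = 0 := by rw [h0]; rfl
    simpa [w, hsC i] using this
  have hcomp : ∀ i, (S.mulVec w.ofLp - lam • w.ofLp) i =
      ∑ j, ((√(D i) * (T' i j - T i j) / √(D j) : ℝ) : ℂ) * w j := by
    intro i
    have h1 := congrFun hTv i
    simp only [Matrix.mulVec, dotProduct, Pi.smul_apply, smul_eq_mul, Matrix.map_apply,
      Complex.coe_algebraMap] at h1
    have h2 : lam * w i = ∑ j, ((√(D i) * T i j / √(D j) : ℝ) : ℂ) * w j := by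
      have : lam * w i = ((√(D i) : ℝ) : ℂ) * (lam * v i) := by simp only [w]; ring
      rw [this, ← h1, Finset.mul_sum]
      refine Finset.sum_congr rfl fun j _ => ?_
      simp only [w]
      push_cast
      field_simp [hsC j]
    simp only [Pi.sub_apply, Pi.smul_apply, smul_eq_mul, Matrix.mulVec, dotProduct, S,
      Matrix.of_apply]
    rw [h2, ← Finset.sum_sub_distrib]
    refine Finset.sum_congr rfl fun j _ => ?_
    push_cast
    ring
  have hle : ‖(WithLp.toLp 2 (S.mulVec w.ofLp - lam • w.ofLp) : EuclideanSpace ℂ ι)‖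
      ≤ c * ‖w‖ := by
    have hnorm : ∀ y : EuclideanSpace ℂ ι, ‖y‖ ≤ ∑ i, ‖y i‖ := by
      intro y
      rw [EuclideanSpace.norm_eq]
      refine Real.sqrt_le_iff.2 ⟨Finset.sum_nonneg fun _ _ => norm_nonneg _, ?_⟩
      exact Finset.sum_sq_le_sq_sum_of_nonneg fun _ _ => norm_nonneg _
    refine (hnorm _).trans ?_
    refine le_trans ?_ (mul_le_mul_of_nonneg_right hc (norm_nonneg w))
    rw [Finset.sum_mul]
    refine Finset.sum_le_sum fun i _ => ?_
    change ‖(S.mulVec w.ofLp - lam • w.ofLp) i‖ ≤ _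
    rw [hcomp, Finset.sum_mul]
    refine (norm_sum_le _ _).trans (Finset.sum_le_sum fun j _ => ?_)
    rw [norm_mul, Complex.norm_real, Real.norm_eq_abs, abs_div, abs_mul, abs_of_pos (hs i),
      abs_of_pos (hs j), abs_sub_comm, Real.sqrt_div (hD i).le, mul_div_right_comm]
    exact mul_le_mul_of_nonneg_left (PiLp.norm_apply_le w j) (by positivity)
  obtain ⟨lam', hl, u, hu, hSu⟩ := hS.exists_eigenvalue_near lam c w hw hle
  refine ⟨lam', (Matrix.mem_spectrum_iff_exists_mulVec _ _).2
    ⟨fun i => u i / ((√(D i) : ℝ) : ℂ), ?_, ?_⟩, hl⟩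
  · intro h0
    apply hu
    ext i
    have := congrFun h0 i
    simpa [hsC i] using this
  · ext i
    have h1 := congrFun hSu i
    simp only [Matrix.mulVec, dotProduct, Pi.smul_apply, smul_eq_mul, Matrix.map_apply,
      Complex.coe_algebraMap, S, Matrix.of_apply] at h1 ⊢
    rw [← mul_div_assoc, ← h1, Finset.sum_div]
    refine Finset.sum_congr rfl fun j _ => ?_
    push_cast
    field_simp [hsC i, hsC j]

/-! ### Short recurrences of Anderson mixing for a symmetric linear system. -/

section LinearCycle

variable {E : Type*} [NormedAddCommGroup E] [InnerProductSpace ℝ E]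

/-- One cycle of full-memory Anderson mixing for the linear system `A u = 0`. Its iterates are
`U j`, the directions are `P j`, and orthogonality is tested in the bilinear form of `K`. -/
structure LinearCycle (A K : E →L[ℝ] E) (b : ℕ → ℝ) (M : ℕ) (U P : ℕ → E)
    (Z G : ℕ → ℕ → ℝ) : Prop where
  symm_A : ∀ x y, inner ℝ (A x) y = inner ℝ x (A y)
  symm_K : ∀ x y, inner ℝ (K x) y = inner ℝ x (K y)
  comm : ∀ x, K (A x) = A (K x)
  step : ∀ j, 1 ≤ j → j ≤ M →
    P j = (U j - U (j - 1)) - ∑ l ∈ Finset.Icc 1 (j - 1), Z j l • P l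
  orth : ∀ j ≤ M, ∀ l ∈ Finset.Icc 1 (j - 1), inner ℝ (P l) (K (A (P j))) = 0
  mix : ∀ j ≤ M, ∀ l ∈ Finset.Icc 1 j,
    inner ℝ (P l) (K (-A (U j) + ∑ i ∈ Finset.Icc 1 j, G j i • A (P i))) = 0
  update : ∀ j < M, U (j + 1) =
    U j + b j • (-A (U j)) - ∑ l ∈ Finset.Icc 1 j, G j l • (P l - b j • A (P l))

/-- The residual after minimization over the current directions. -/
def mixedResidual (A : E →L[ℝ] E) (U P : ℕ → E) (G : ℕ → ℕ → ℝ) (j : ℕ) : E :=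
  -A (U j) + ∑ i ∈ Finset.Icc 1 j, G j i • A (P i)

namespace LinearCycle

variable {A K : E →L[ℝ] E} {b : ℕ → ℝ} {M : ℕ} {U P : ℕ → E} {Z G : ℕ → ℕ → ℝ}

theorem form_symm (h : LinearCycle A K b M U P Z G) (x y : E) :
    inner ℝ x (K (A y)) = inner ℝ y (K (A x)) := by
  rw [← h.symm_K, ← h.symm_A, real_inner_comm, h.comm]

theorem form_eq_zero (h : LinearCycle A K b M U P Z G) {i j : ℕ} (hi : 1 ≤ i) (hi' : i ≤ M)
    (hj : 1 ≤ j) (hj' : j ≤ M) (hij : i ≠ j) : inner ℝ (P i) (K (A (P j))) = 0 := by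
  rcases lt_or_gt_of_ne hij with hlt | hlt
  · exact h.orth j hj' i (Finset.mem_Icc.2 ⟨hi, by omega⟩)
  · rw [h.form_symm]
    exact h.orth i hi' j (Finset.mem_Icc.2 ⟨hj, by omega⟩)

theorem sum_form (h : LinearCycle A K b M U P Z G) (c : ℕ → ℝ) {n l : ℕ}
    (hl : l ∈ Finset.Icc 1 n) (hn : n ≤ M) :
    inner ℝ (P l) (K (∑ i ∈ Finset.Icc 1 n, c i • A (P i)))
      = c l * inner ℝ (P l) (K (A (P l))) := by
  obtain ⟨h1, h2⟩ := Finset.mem_Icc.1 hl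
  rw [map_sum, inner_sum, Finset.sum_eq_single_of_mem l hl]
  · rw [map_smul, inner_smul_right]
  · intro i hi hil
    obtain ⟨h3, h4⟩ := Finset.mem_Icc.1 hi
    rw [map_smul, inner_smul_right, h.form_eq_zero h1 (by omega) h3 (by omega) (Ne.symm hil),
      mul_zero]

theorem inner_mixedResidual (h : LinearCycle A K b M U P Z G) {j l : ℕ} (hj : j ≤ M)
    (hl : l ∈ Finset.Icc 1 j) : inner ℝ (P l) (K (mixedResidual A U P G j)) = 0 :=
  h.mix j hj l hl

theorem direction_succ (h : LinearCycle A K b M U P Z G) {i : ℕ} (hi : i < M) :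
    P (i + 1) = b i • mixedResidual A U P G i
      - ∑ l ∈ Finset.Icc 1 i, (G i l + Z (i + 1) l) • P l := by
  rw [h.step (i + 1) (by omega) hi, h.update i hi, Nat.add_sub_cancel, mixedResidual, smul_add,
    Finset.smul_sum]
  simp only [add_smul, smul_sub, Finset.sum_add_distrib, Finset.sum_sub_distrib]
  have : ∑ l ∈ Finset.Icc 1 i, G i l • b i • A (P l)
      = ∑ l ∈ Finset.Icc 1 i, b i • G i l • A (P l) :=
    Finset.sum_congr rfl fun l _ => smul_comm _ _ _
  rw [this]
  abel

theorem residual_succ (h : LinearCycle A K b M U P Z G) {i : ℕ} (hi : i < M) :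
    -A (U (i + 1)) = mixedResidual A U P G i - b i • A (mixedResidual A U P G i) := by
  rw [h.update i hi, mixedResidual]
  simp only [map_sub, map_add, map_smul, map_neg, map_sum, smul_add, smul_neg, smul_sub,
    Finset.smul_sum, Finset.sum_sub_distrib]
  have : ∑ l ∈ Finset.Icc 1 i, G i l • b i • A (A (P l))
      = ∑ l ∈ Finset.Icc 1 i, b i • G i l • A (A (P l)) :=
    Finset.sum_congr rfl fun l _ => smul_comm _ _ _
  rw [this]
  abel

theorem mixedResidual_succ (h : LinearCycle A K b M U P Z G) {i : ℕ} (hi : i < M) :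
    mixedResidual A U P G (i + 1) = mixedResidual A U P G i
      - (1 - G (i + 1) (i + 1)) • A (P (i + 1))
      + ∑ l ∈ Finset.Icc 1 i, (G (i + 1) l - (G i l + Z (i + 1) l)) • A (P l) := by
  have h1 : b i • A (mixedResidual A U P G i)
      = A (P (i + 1)) + ∑ l ∈ Finset.Icc 1 i, (G i l + Z (i + 1) l) • A (P l) := by
    rw [h.direction_succ hi]
    simp only [map_sub, map_smul, map_sum]
    abel
  conv_lhs => rw [mixedResidual, h.residual_succ hi, h1,
    ← Finset.insert_Icc_right_eq_Icc_add_one (by omega : 1 ≤ i + 1),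
    Finset.sum_insert (by simp)]
  simp only [sub_smul, Finset.sum_sub_distrib, one_smul]
  abel

/-- The mixing coefficients on earlier directions are inherited from the preceding step. -/
theorem coeff_eq (h : LinearCycle A K b M U P Z G) {i l : ℕ} (hi : i < M)
    (hl : l ∈ Finset.Icc 1 i) (hD : inner ℝ (P l) (K (A (P l))) ≠ 0) :
    G (i + 1) l = G i l + Z (i + 1) l := by
  obtain ⟨h1, h2⟩ := Finset.mem_Icc.1 hl
  have e := congrArg (fun y => inner ℝ (P l) (K y)) (h.mixedResidual_succ hi)
  simp only [map_sub, map_add, inner_add_right, inner_sub_right, map_smul,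
    inner_smul_right] at e
  rw [h.inner_mixedResidual (by omega) (Finset.mem_Icc.2 ⟨h1, by omega⟩),
    h.inner_mixedResidual (by omega) hl, h.form_eq_zero h1 (by omega) (by omega) hi (by omega),
    h.sum_form (fun l => G (i + 1) l - (G i l + Z (i + 1) l)) hl (by omega)] at e
  have := (mul_eq_zero.1 (show (G (i + 1) l - (G i l + Z (i + 1) l)) *
    inner ℝ (P l) (K (A (P l))) = 0 by linarith)).resolve_right hD
  linarith

/-- By `coeff_eq` the sum over earlier directions in `mixedResidual_succ` cancels. Since residuals
are in turn combinations of directions, this identity is the source of the tridiagonal structure. -/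
theorem apply_direction (h : LinearCycle A K b M U P Z G) {i : ℕ} (hi : i < M)
    (hD : ∀ l ∈ Finset.Icc 1 i, inner ℝ (P l) (K (A (P l))) ≠ 0) :
    (1 - G (i + 1) (i + 1)) • A (P (i + 1))
      = mixedResidual A U P G i - mixedResidual A U P G (i + 1) := by
  have h1 := h.mixedResidual_succ hi
  rw [Finset.sum_eq_zero, add_zero] at h1
  · rw [h1]
    abel
  · intro l hl
    rw [h.coeff_eq hi hl (hD l hl), sub_self, zero_smul]

/-- By `direction_succ`, `b_j` times the earlier residual is a combination of `P_1, …, P_{j+1}`, and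
the later residual is `K`-orthogonal to all of these. -/
theorem inner_mixedResidual_mixedResidual (h : LinearCycle A K b M U P Z G) {i j : ℕ}
    (hji : j < i) (hi : i ≤ M) (hb : b j ≠ 0) :
    inner ℝ (mixedResidual A U P G j) (K (mixedResidual A U P G i)) = 0 := by
  have h1 : b j • mixedResidual A U P G j
      = P (j + 1) + ∑ l ∈ Finset.Icc 1 j, (G j l + Z (j + 1) l) • P l := by
    rw [h.direction_succ (by omega)]
    abel
  have h2 : inner ℝ (b j • mixedResidual A U P G j) (K (mixedResidual A U P G i)) = 0 := by
    rw [h1, inner_add_left, h.inner_mixedResidual hi (Finset.mem_Icc.2 ⟨by omega, by omega⟩),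
      sum_inner, zero_add]
    refine Finset.sum_eq_zero fun l hl => ?_
    obtain ⟨h3, h4⟩ := Finset.mem_Icc.1 hl
    rw [inner_smul_left, h.inner_mixedResidual hi (Finset.mem_Icc.2 ⟨h3, by omega⟩), mul_zero]
  rw [inner_smul_left] at h2
  exact (mul_eq_zero.1 h2).resolve_left (by simpa using hb)

/-- The recurrence for the directions is short. -/
theorem phi_eq_zero (h : LinearCycle A K b M U P Z G) (hb : ∀ j, b j ≠ 0) {i j : ℕ} (hi : i < M)
    (hj : 1 ≤ j) (hji : j < i) (hD : ∀ l ∈ Finset.Icc 1 j, inner ℝ (P l) (K (A (P l))) ≠ 0)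
    (hG : G j j ≠ 1) : G i j + Z (i + 1) j = 0 := by
  obtain ⟨j, rfl⟩ : ∃ j', j = j' + 1 := ⟨j - 1, by omega⟩
  -- Moving `A` to the left factor turns `P (j + 1)` into a difference of two residuals that precede
  -- step `i`. Testing `direction_succ` with `P (j + 1)` then isolates the coefficient.
  have h1 : inner ℝ (P (j + 1)) (K (A (mixedResidual A U P G i))) = 0 := by
    have h2 : inner ℝ ((1 - G (j + 1) (j + 1)) • A (P (j + 1)))
        (K (mixedResidual A U P G i)) = 0 := by
      rw [h.apply_direction (by omega)
        fun l hl => hD l (Finset.Icc_subset_Icc_right (by omega) hl), inner_sub_left,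
        h.inner_mixedResidual_mixedResidual (by omega) (by omega) (hb _),
        h.inner_mixedResidual_mixedResidual (by omega) (by omega) (hb _), sub_zero]
    rw [inner_smul_left, h.symm_A, ← h.comm] at h2
    refine (mul_eq_zero.1 h2).resolve_left ?_
    simpa [sub_eq_zero] using hG.symm
  have hmem : j + 1 ∈ Finset.Icc 1 i := Finset.mem_Icc.2 ⟨hj, hji.le⟩
  have e := congrArg (fun y => inner ℝ (P (j + 1)) (K (A y))) (h.direction_succ hi)
  simp only [map_sub, inner_sub_right, map_smul, inner_smul_right, map_sum] at e
  have h3 := h.sum_form (fun l => G i l + Z (i + 1) l) hmem (by omega)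
  simp only [map_sum, map_smul] at h3
  rw [h1, h3, h.form_eq_zero (by omega) (by omega) (by omega) (by omega) (by omega)] at e
  refine (mul_eq_zero.1 (show (G i (j + 1) + Z (i + 1) (j + 1)) *
    inner ℝ (P (j + 1)) (K (A (P (j + 1)))) = 0 by linarith)).resolve_right ?_
  exact hD _ (Finset.mem_Icc.2 ⟨hj, le_rfl⟩)

/-- This and `stepCoeff_eq_zero` justify the truncated memory: the ranges of `l` are those skipped
by sweeps starting at `i - 1` and `i - 2`. Only directions up to `l` must be nondegenerate, so the
lemmas can be used inside an induction over the cycle. -/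
theorem mixCoeff_eq_zero (h : LinearCycle A K b M U P Z G) (hb : ∀ j, b j ≠ 0) {i l : ℕ}
    (hi : i ≤ M) (hl : 1 ≤ l) (hli : l + 1 < i)
    (hD : ∀ j ∈ Finset.Icc 1 l, inner ℝ (P j) (K (A (P j))) ≠ 0) (hG : G l l ≠ 1) :
    G i l = 0 := by
  obtain ⟨i, rfl⟩ : ∃ i', i = i' + 1 := ⟨i - 1, by omega⟩
  rw [h.coeff_eq (by omega) (Finset.mem_Icc.2 ⟨hl, by omega⟩)
    (hD l (Finset.mem_Icc.2 ⟨hl, le_rfl⟩))]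
  exact h.phi_eq_zero hb (by omega) hl (by omega) hD hG

theorem stepCoeff_eq_zero (h : LinearCycle A K b M U P Z G) (hb : ∀ j, b j ≠ 0) {i l : ℕ}
    (hi : i ≤ M) (hl : 1 ≤ l) (hli : l + 2 < i)
    (hD : ∀ j ∈ Finset.Icc 1 l, inner ℝ (P j) (K (A (P j))) ≠ 0) (hG : G l l ≠ 1) :
    Z i l = 0 := by
  obtain ⟨i, rfl⟩ : ∃ i', i = i' + 1 := ⟨i - 1, by omega⟩
  have h1 := h.phi_eq_zero hb (i := i) (by omega) hl (by omega) hD hG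
  rwa [h.mixCoeff_eq_zero hb (by omega) hl (by omega) hD hG, zero_add] at h1

end LinearCycle

end LinearCycle

/-! ### Three-term recurrence and the Lanczos property. -/

/-- Entries of the tridiagonal matrix of a cycle, in terms of the mixing parameters `b`, the sums
`φ` of coefficients and the last mixing coefficients `γ`. -/
noncomputable def tridiagEntry (b φ γ : ℕ → ℝ) (a c : ℕ) : ℝ :=
  if a + 1 = c then φ c / (b c * (1 - γ (c + 1)))
  else if a = c then 1 / (1 - γ (c + 1)) * (1 / b c - φ (c + 1) / b (c + 1))
  else if a = c + 1 then -(1 / (b (c + 1) * (1 - γ (c + 1))))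
  else 0

theorem amTridiag_apply (β : ℕ → ℝ) (n : ℕ → ℕ) (ζ Γ : ℕ → ℕ → ℝ) (k : ℕ) (a c : Fin (n k)) :
    amTridiag β n ζ Γ k a c =
      tridiagEntry (fun j => β (k - n k + j)) (fun j => amPhi n ζ Γ (k - n k + j))
        (fun j => Γ (k - n k + j) (n (k - n k + j))) a c := by
  have h1 : k - n k + 1 + (c : ℕ) = k - n k + (c + 1) := by ring
  have h2 : k - n k + ((c : ℕ) + 1) - 1 = k - n k + c := by omega
  simp only [amTridiag, tridiagEntry, Matrix.of_apply, h1, h2]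

/-- The coefficient of the last direction in the recurrence for the directions. -/
def lastPhi (Z G : ℕ → ℕ → ℝ) (i : ℕ) : ℝ :=
  if i = 0 then 0 else G i i + Z (i + 1) i

theorem Finset.sum_range_eq_add_of_ne {M : Type*} [AddCommMonoid M] (f : ℕ → M) (N i : ℕ)
    (hi : i + 1 < N) (hf : ∀ e, e ≠ i → e ≠ i + 1 → f e = 0) :
    ∑ e ∈ Finset.range N, f e = f i + f (i + 1) := by
  rw [← Finset.sum_pair (by omega : i ≠ i + 1)]
  refine (Finset.sum_subset ?_ ?_).symm
  · intro e he
    simp only [Finset.mem_insert, Finset.mem_singleton] at he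
    exact Finset.mem_range.2 (by omega)
  · intro e _ he
    simp only [Finset.mem_insert, Finset.mem_singleton, not_or] at he
    exact hf e he.1 he.2

namespace LinearCycle

variable {E : Type*} [NormedAddCommGroup E] [InnerProductSpace ℝ E]
variable {A K : E →L[ℝ] E} {b : ℕ → ℝ} {N : ℕ} {U P : ℕ → E} {Z G : ℕ → ℕ → ℝ}

theorem direction_succ_short (h : LinearCycle A K b (N + 1) U P Z G) (hb : ∀ j, b j ≠ 0)
    (hD : ∀ l ∈ Finset.Icc 1 N, inner ℝ (P l) (K (A (P l))) ≠ 0)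
    (hG : ∀ l ∈ Finset.Icc 1 N, G l l ≠ 1) {i : ℕ} (hi : i ≤ N) :
    P (i + 1) = b i • mixedResidual A U P G i - lastPhi Z G i • P i := by
  rw [h.direction_succ (by omega)]
  congr 1
  rcases Nat.eq_zero_or_pos i with rfl | hpos
  · simp [lastPhi]
  · rw [Finset.sum_eq_single_of_mem i (Finset.mem_Icc.2 ⟨hpos, le_rfl⟩)]
    · rw [lastPhi, if_neg (by omega)]
    · intro j hj hji
      obtain ⟨h1, h2⟩ := Finset.mem_Icc.1 hj
      rw [h.phi_eq_zero hb (by omega) h1 (by omega)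
        (fun l hl => hD l (Finset.Icc_subset_Icc_right (by omega) hl))
        (hG j (Finset.mem_Icc.2 ⟨h1, by omega⟩)), zero_smul]

/-- The three-term recurrence of the directions of a cycle. -/
theorem three_term (h : LinearCycle A K b (N + 1) U P Z G) (hb : ∀ j, b j ≠ 0)
    (hD : ∀ l ∈ Finset.Icc 1 N, inner ℝ (P l) (K (A (P l))) ≠ 0)
    (hG : ∀ l ∈ Finset.Icc 1 N, G l l ≠ 1) {c : ℕ} (hc : c < N) :
    A (P (c + 1)) = ∑ e ∈ Finset.range (N + 1),
      tridiagEntry b (lastPhi Z G) (fun j => G j j) e c • P (e + 1) := by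
  have hg : 1 - G (c + 1) (c + 1) ≠ 0 := by
    have := hG (c + 1) (Finset.mem_Icc.2 ⟨by omega, by omega⟩)
    intro h0
    exact this (by linarith)
  have hres : ∀ i ≤ N, mixedResidual A U P G i = (1 / b i) • (P (i + 1) + lastPhi Z G i • P i) := by
    intro i hi
    rw [h.direction_succ_short hb hD hG hi, sub_add_cancel, smul_smul,
      one_div_mul_cancel (hb i), one_smul]
  have h1 := h.apply_direction (i := c) (by omega)
    fun l hl => hD l (Finset.Icc_subset_Icc_right (by omega) hl)
  have h2 : A (P (c + 1)) = (1 / (1 - G (c + 1) (c + 1))) •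
      (mixedResidual A U P G c - mixedResidual A U P G (c + 1)) := by
    rw [← h1, smul_smul, one_div_mul_cancel hg, one_smul]
  rw [h2, hres c (by omega), hres (c + 1) (by omega)]
  -- The first column has no entry above the diagonal: `lastPhi` is zero at `0`, so the meaningless
  -- vector `P 0` does not enter.
  rcases Nat.eq_zero_or_pos c with rfl | hpos
  · rw [Finset.sum_range_eq_add_of_ne _ _ 0 (by omega)]
    · simp only [tridiagEntry, lastPhi]
      norm_num
      match_scalars <;> field_simp
    · intro e h3 h4
      rw [tridiagEntry, if_neg (by omega), if_neg (by omega), if_neg (by omega), zero_smul]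
  · obtain ⟨c, rfl⟩ : ∃ c', c = c' + 1 := ⟨c - 1, by omega⟩
    have hs : ∑ e ∈ Finset.range (N + 1),
        tridiagEntry b (lastPhi Z G) (fun j => G j j) e (c + 1) • P (e + 1)
        = tridiagEntry b (lastPhi Z G) (fun j => G j j) c (c + 1) • P (c + 1)
        + (tridiagEntry b (lastPhi Z G) (fun j => G j j) (c + 1) (c + 1) • P (c + 1 + 1)
        + tridiagEntry b (lastPhi Z G) (fun j => G j j) (c + 2) (c + 1) • P (c + 2 + 1)) := by
      rw [← Finset.sum_erase_add _ _ (Finset.mem_range.2 (by omega : c < N + 1)), add_comm]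
      congr 1
      rw [← Finset.sum_pair (f := fun e => tridiagEntry b (lastPhi Z G) (fun j => G j j) e (c + 1)
        • P (e + 1)) (by omega : c + 1 ≠ c + 2)]
      refine (Finset.sum_subset ?_ ?_).symm
      · intro e he
        simp only [Finset.mem_insert, Finset.mem_singleton] at he
        exact Finset.mem_erase.2 ⟨by omega, Finset.mem_range.2 (by omega)⟩
      · intro e he he'
        simp only [Finset.mem_insert, Finset.mem_singleton, not_or] at he'
        have := (Finset.mem_erase.1 he).1
        rw [tridiagEntry, if_neg (by omega), if_neg (by omega), if_neg (by omega), zero_smul]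
    rw [hs]
    have e1 : tridiagEntry b (lastPhi Z G) (fun j => G j j) c (c + 1) =
        lastPhi Z G (c + 1) / (b (c + 1) * (1 - G (c + 1 + 1) (c + 1 + 1))) := by
      simp [tridiagEntry]
    have e2 : tridiagEntry b (lastPhi Z G) (fun j => G j j) (c + 1) (c + 1) =
        1 / (1 - G (c + 1 + 1) (c + 1 + 1)) *
          (1 / b (c + 1) - lastPhi Z G (c + 2) / b (c + 2)) := by
      simp [tridiagEntry]
    have e3 : tridiagEntry b (lastPhi Z G) (fun j => G j j) (c + 2) (c + 1) =
        -(1 / (b (c + 2) * (1 - G (c + 1 + 1) (c + 1 + 1)))) := by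
      rw [tridiagEntry, if_neg (by omega), if_neg (by omega), if_pos (by omega)]
    rw [e1, e2, e3]
    have hb1 := hb (c + 1)
    have hb2 := hb (c + 2)
    match_scalars <;> field_simp

/-- The bound `n` is left free because the recurrence reaches `P (N + 1)` while the matrix has size
`N`: by orthogonality the dropped entry is invisible to the projection. -/
theorem inner_sum_directions (h : LinearCycle A K b (N + 1) U P Z G) (f : ℕ → ℝ) {a n : ℕ}
    (ha : a < n) (hn : n ≤ N + 1) :
    ∑ e ∈ Finset.range n, inner ℝ (P (a + 1)) (K (A (P (e + 1)))) * f e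
      = inner ℝ (P (a + 1)) (K (A (P (a + 1)))) * f a := by
  refine Finset.sum_eq_single_of_mem a (Finset.mem_range.2 (by omega)) fun e he hea => ?_
  have := Finset.mem_range.1 he
  rw [h.form_eq_zero (by omega) (by omega) (by omega) (by omega) (by omega), zero_mul]

theorem projection (h : LinearCycle A K b (N + 1) U P Z G) (hb : ∀ j, b j ≠ 0)
    (hD : ∀ l ∈ Finset.Icc 1 N, inner ℝ (P l) (K (A (P l))) ≠ 0)
    (hG : ∀ l ∈ Finset.Icc 1 N, G l l ≠ 1) {a c : ℕ} (ha : a < N) (hc : c < N) :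
    inner ℝ (P (a + 1)) (K (A (A (P (c + 1))))) = inner ℝ (P (a + 1)) (K (A (P (a + 1)))) *
      tridiagEntry b (lastPhi Z G) (fun j => G j j) a c := by
  rw [h.three_term hb hD hG hc, map_sum, map_sum, inner_sum,
    ← h.inner_sum_directions (fun e => tridiagEntry b (lastPhi Z G) (fun j => G j j) e c)
      (by omega : a < N + 1) le_rfl]
  refine Finset.sum_congr rfl fun e _ => ?_
  rw [map_smul, map_smul, inner_smul_right, mul_comm]

theorem span_directions (h : LinearCycle A K b (N + 1) U P Z G) (hb : ∀ j, b j ≠ 0)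
    (hD : ∀ l ∈ Finset.Icc 1 N, inner ℝ (P l) (K (A (P l))) ≠ 0)
    (hG : ∀ l ∈ Finset.Icc 1 N, G l l ≠ 1) {j : ℕ} (hj : j ≤ N) :
    Submodule.span ℝ ((fun i => P (i + 1)) '' Set.Iic j) =
      Submodule.span ℝ ((fun i => (A ^ i) (-A (U 0))) '' Set.Iic j) := by
  have hIic : ∀ j : ℕ, Set.Iic (j + 1) = insert (j + 1) (Set.Iic j) := by
    intro j
    ext i
    simp only [Set.mem_Iic, Set.mem_insert_iff]
    omega
  induction j with
  | zero =>
    have h0 : P 1 = b 0 • (-A (U 0)) := by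
      rw [h.direction_succ (by omega)]
      simp [mixedResidual]
    have h1 : Set.Iic 0 = {0} := by
      ext i
      simp
    rw [h1, Set.image_singleton, Set.image_singleton, zero_add, h0, pow_zero]
    exact Submodule.span_singleton_smul_eq (IsUnit.mk0 _ (hb 0)) _
  | succ j ih =>
    have ih := ih (by omega)
    set S := Submodule.span ℝ ((fun i => P (i + 1)) '' Set.Iic j) with hS
    have hmem : ∀ i ≤ j, P (i + 1) ∈ S := fun i hi => Submodule.subset_span ⟨i, hi, rfl⟩
    have htri : ∀ i ≤ j, ∃ y ∈ S, A (P (i + 1)) = y +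
        tridiagEntry b (lastPhi Z G) (fun j => G j j) (j + 1) i • P (j + 1 + 1) := by
      intro i hi
      refine ⟨∑ e ∈ (Finset.range (N + 1)).erase (j + 1),
        tridiagEntry b (lastPhi Z G) (fun j => G j j) e i • P (e + 1), ?_, ?_⟩
      · refine Submodule.sum_mem _ fun e he => ?_
        have he1 := (Finset.mem_erase.1 he).1
        rcases le_or_gt e j with hej | hej
        · exact Submodule.smul_mem _ _ (hmem e hej)
        · rw [tridiagEntry, if_neg (by omega), if_neg (by omega), if_neg (by omega), zero_smul]
          exact Submodule.zero_mem _
      · rw [h.three_term hb hD hG (by omega),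
          Finset.sum_erase_add _ _ (Finset.mem_range.2 (by omega))]
    rw [hIic, Set.image_insert_eq, Set.image_insert_eq, Submodule.span_insert,
      Submodule.span_insert, ← ih, ← hS]
    refine le_antisymm (sup_le ?_ le_sup_right) (sup_le ?_ le_sup_right)
    · rw [Submodule.span_singleton_le_iff_mem]
      obtain ⟨y, hy, hAy⟩ := htri j le_rfl
      have ht : tridiagEntry b (lastPhi Z G) (fun j => G j j) (j + 1) j ≠ 0 := by
        rw [tridiagEntry, if_neg (by omega), if_neg (by omega), if_pos rfl]
        refine neg_ne_zero.2 (one_div_ne_zero (mul_ne_zero (hb _) ?_))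
        have := hG (j + 1) (Finset.mem_Icc.2 ⟨by omega, by omega⟩)
        exact fun h0 => this (by linarith)
      -- The subdiagonal entry is nonzero, so the recurrence can be solved for the new direction;
      -- this is why the Krylov space gains nothing beyond one power of `A`.
      have hP : P (j + 1 + 1) =
          (tridiagEntry b (lastPhi Z G) (fun j => G j j) (j + 1) j)⁻¹ • (A (P (j + 1)) - y) := by
        rw [hAy, add_sub_cancel_left, smul_smul, inv_mul_cancel₀ ht, one_smul]
      rw [hP]
      refine Submodule.smul_mem _ _ (Submodule.sub_mem _ ?_
        (Submodule.mem_sup_right hy))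
      have hle : S ≤ Submodule.comap (A : E →ₗ[ℝ] E)
          (Submodule.span ℝ {(A ^ (j + 1)) (-A (U 0))} ⊔ S) := by
        conv_lhs => rw [ih]
        rw [Submodule.span_le]
        rintro _ ⟨i, hi, rfl⟩
        have hA : A ((A ^ i) (-A (U 0))) = (A ^ (i + 1)) (-A (U 0)) := by
          rw [pow_succ']
          rfl
        change A ((A ^ i) (-A (U 0))) ∈ Submodule.span ℝ {(A ^ (j + 1)) (-A (U 0))} ⊔ S
        rw [hA]
        rcases Nat.lt_or_ge i j with hij | hij
        · refine Submodule.mem_sup_right ?_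
          rw [ih]
          exact Submodule.subset_span ⟨i + 1, hij, rfl⟩
        · have : i = j := le_antisymm hi hij
          subst this
          exact Submodule.mem_sup_left (Submodule.mem_span_singleton_self _)
      exact hle (hmem j le_rfl)
    · rw [Submodule.span_singleton_le_iff_mem]
      have hle : S ≤ Submodule.comap (A : E →ₗ[ℝ] E)
          (Submodule.span ℝ {P (j + 1 + 1)} ⊔ S) := by
        conv_lhs => rw [hS]
        rw [Submodule.span_le]
        rintro _ ⟨i, hi, rfl⟩
        obtain ⟨y, hy, hAy⟩ := htri i hi
        change A (P (i + 1)) ∈ Submodule.span ℝ {P (j + 1 + 1)} ⊔ S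
        rw [hAy]
        exact Submodule.add_mem _ (Submodule.mem_sup_right hy) (Submodule.mem_sup_left
          (Submodule.smul_mem _ _ (Submodule.mem_span_singleton_self _)))
      have hA : (A ^ (j + 1)) (-A (U 0)) = A ((A ^ j) (-A (U 0))) := by
        rw [pow_succ']
        rfl
      rw [hA]
      refine hle ?_
      rw [ih]
      exact Submodule.subset_span ⟨j, Set.mem_Iic.2 le_rfl, rfl⟩

end LinearCycle

/-- The directions of a nondegenerate cycle for a linear system form a Lanczos basis. -/
theorem LinearCycle.isLanczosMatrix {d : ℕ}
    {A K B : EuclideanSpace ℝ (Fin d) →L[ℝ] EuclideanSpace ℝ (Fin d)} {b : ℕ → ℝ} {N : ℕ}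
    {U P : ℕ → EuclideanSpace ℝ (Fin d)} {Z G : ℕ → ℕ → ℝ}
    (h : LinearCycle A K b (N + 1) U P Z G) (hB : ∀ y, B y = K (A y)) (hb : ∀ j, b j ≠ 0)
    (hD : ∀ l ∈ Finset.Icc 1 N, 0 < inner ℝ (P l) (K (A (P l))))
    (hG : ∀ l ∈ Finset.Icc 1 N, G l l ≠ 1) :
    IsLanczosMatrix B A (-A (U 0)) (fun i : Fin N => P ((i : ℕ) + 1))
      (Matrix.of fun a c : Fin N => tridiagEntry b (lastPhi Z G) (fun j => G j j) a c) := by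
  have hD' : ∀ l ∈ Finset.Icc 1 N, inner ℝ (P l) (K (A (P l))) ≠ 0 := fun l hl => (hD l hl).ne'
  refine ⟨fun j => ?_, fun i j hij => ?_, fun i => ?_, fun i j => ?_⟩
  · have h1 : (fun i : Fin N => P ((i : ℕ) + 1)) '' Set.Iic j =
        (fun i : ℕ => P (i + 1)) '' Set.Iic (j : ℕ) := by
      ext y
      constructor
      · rintro ⟨i, hi, rfl⟩
        exact ⟨i, hi, rfl⟩
      · rintro ⟨i, hi, rfl⟩
        exact ⟨⟨i, lt_of_le_of_lt hi j.2⟩, hi, rfl⟩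
    have h2 : (Set.range fun i : Fin ((j : ℕ) + 1) => (A ^ (i : ℕ)) (-A (U 0))) =
        (fun i : ℕ => (A ^ i) (-A (U 0))) '' Set.Iic (j : ℕ) := by
      ext y
      constructor
      · rintro ⟨i, rfl⟩
        exact ⟨i, Nat.lt_succ_iff.1 i.2, rfl⟩
      · rintro ⟨i, hi, rfl⟩
        exact ⟨⟨i, Nat.lt_succ_iff.2 hi⟩, rfl⟩
    rw [h1, krylov, h2]
    exact h.span_directions hb hD' hG j.2.le
  · have := Fin.val_ne_of_ne hij
    rw [hB]
    exact h.form_eq_zero (by omega) (by omega) (by omega) (by omega) (by omega)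
  · rw [hB]
    exact hD _ (Finset.mem_Icc.2 ⟨by omega, i.2⟩)
  · simp only [hB, Matrix.of_apply]
    rw [h.projection hb hD' hG i.2 j.2,
      Fin.sum_univ_eq_sum_range (fun e => inner ℝ (P ((i : ℕ) + 1)) (K (A (P (e + 1)))) *
        tridiagEntry b (lastPhi Z G) (fun j => G j j) e j) N,
      h.inner_sum_directions (fun e => tridiagEntry b (lastPhi Z G) (fun j => G j j) e j) i.2
        (by omega)]

/-! ### Landau calculus for quantities of size `ε` with relative perturbation `e`. -/

section Asymptotics

open Asymptotics

variable {Ω E : Type*} [NormedAddCommGroup E] [InnerProductSpace ℝ E] {l : Filter Ω}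

theorem Asymptotics.IsBigO.real_inner {x y : Ω → E} {f g : Ω → ℝ} (hx : x =O[l] f)
    (hy : y =O[l] g) : (fun ω => inner ℝ (x ω) (y ω)) =O[l] fun ω => f ω * g ω := by
  refine IsBigO.trans (isBigO_of_le _ fun ω => ?_) (hx.norm_left.mul hy.norm_left)
  rw [norm_mul, _root_.norm_norm, _root_.norm_norm]
  exact norm_inner_le_norm _ _

/-- No nonvanishing of `b` is needed, since a quotient by zero is zero. -/
theorem Asymptotics.IsBigO.div_of_mul {a b f : Ω → ℝ} (h : a =O[l] fun ω => f ω * b ω) :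
    (fun ω => a ω / b ω) =O[l] f := by
  obtain ⟨C, hC0, hC⟩ := h.exists_nonneg
  refine IsBigO.of_bound C (hC.bound.mono fun ω hω => ?_)
  rcases eq_or_ne (b ω) 0 with h0 | h0
  · rw [h0, div_zero, norm_zero]
    positivity
  · rw [norm_div, div_le_iff₀ (norm_pos_iff.2 h0)]
    rw [norm_mul] at hω
    linarith

variable {ε e : Ω → ℝ}

theorem Asymptotics.IsBigO.of_sub_left {F : Type*} [NormedAddCommGroup F] {x y : Ω → F}
    {f : Ω → ℝ} (hx : x =O[l] f) (he : e =O[l] fun _ => (1 : ℝ))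
    (hxy : (fun ω => x ω - y ω) =O[l] fun ω => e ω * f ω) : y =O[l] f := by
  have h1 : (fun ω => e ω * f ω) =O[l] f := by
    simpa using he.mul (isBigO_refl f l)
  simpa using hx.sub (hxy.trans h1)

theorem isBigO_inner_sub_inner {x x' y y' : Ω → E} (he : e =O[l] fun _ => (1 : ℝ))
    (hx : x =O[l] ε) (hy : y =O[l] ε)
    (hxx : (fun ω => x ω - x' ω) =O[l] fun ω => e ω * ε ω)
    (hyy : (fun ω => y ω - y' ω) =O[l] fun ω => e ω * ε ω) :
    (fun ω => (inner ℝ (x ω) (y ω) - inner ℝ (x' ω) (y' ω) : ℝ)) =O[l]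
      fun ω => e ω * (ε ω * ε ω) := by
  have hx' := hx.of_sub_left he hxx
  have h1 := (hxx.real_inner hy).congr_right (g₂ := fun ω => e ω * (ε ω * ε ω))
    fun ω => by ring
  have h2 := (hx'.real_inner hyy).congr_right (g₂ := fun ω => e ω * (ε ω * ε ω))
    fun ω => by ring
  refine (h1.add h2).congr_left fun ω => ?_
  rw [inner_sub_left, inner_sub_right]
  ring

theorem isBigO_smul_sub_smul {a a' : Ω → ℝ} {x x' : Ω → E} (he : e =O[l] fun _ => (1 : ℝ))
    (ha : a =O[l] fun _ => (1 : ℝ)) (hx : x =O[l] ε)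
    (haa : (fun ω => a ω - a' ω) =O[l] e)
    (hxx : (fun ω => x ω - x' ω) =O[l] fun ω => e ω * ε ω) :
    (fun ω => a ω • x ω - a' ω • x' ω) =O[l] fun ω => e ω * ε ω := by
  have ha' : a' =O[l] fun _ => (1 : ℝ) := by
    simpa using ha.sub (haa.trans he)
  have h1 := haa.smul hx
  have h2 := (ha'.smul hxx).congr_right (g₂ := fun ω => e ω * ε ω) fun ω => by simp
  refine (h1.add h2).congr_left fun ω => ?_
  simp only [sub_smul, smul_sub]
  abel

theorem isBigO_mul_sub_mul {a a' x x' : Ω → ℝ} (he : e =O[l] fun _ => (1 : ℝ))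
    (ha : a =O[l] fun _ => (1 : ℝ)) (hx : x =O[l] fun _ => (1 : ℝ))
    (haa : (fun ω => a ω - a' ω) =O[l] e)
    (hxx : (fun ω => x ω - x' ω) =O[l] e) :
    (fun ω => a ω * x ω - a' ω * x' ω) =O[l] e := by
  have := isBigO_smul_sub_smul (ε := fun _ => 1) he ha hx haa (by simpa using hxx)
  simpa using this

/-- A lower bound of order `ε²` survives a perturbation of order `e ε²`, because the latter is
negligible. This carries nondegeneracy from one process to the other. -/
theorem isBigO_of_isBigO_sub {b b' : Ω → ℝ} (he : e =o[l] fun _ => (1 : ℝ))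
    (hb : (fun ω => ε ω * ε ω) =O[l] b)
    (hbb : (fun ω => b ω - b' ω) =O[l] fun ω => e ω * (ε ω * ε ω)) :
    (fun ω => ε ω * ε ω) =O[l] b' := by
  have h1 : (fun ω => e ω * (ε ω * ε ω)) =o[l] fun ω => ε ω * ε ω := by
    simpa using he.mul_isBigO (isBigO_refl (fun ω => ε ω * ε ω) l)
  have h2 : (fun ω => b' ω - b ω) =o[l] b := by
    refine IsLittleO.trans_isBigO (IsBigO.trans_isLittleO ?_ h1) hb
    exact hbb.neg_left.congr_left fun ω => by ring
  have h3 := h2.right_isBigO_add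
  exact hb.trans (h3.congr_right fun ω => by ring)

theorem isBigO_div_sub_div {a a' b b' : Ω → ℝ} (he : e =o[l] fun _ => (1 : ℝ))
    (hε : ∀ᶠ ω in l, ε ω ≠ 0)
    (ha : a =O[l] fun ω => ε ω * ε ω) (hb : (fun ω => ε ω * ε ω) =O[l] b)
    (haa : (fun ω => a ω - a' ω) =O[l] fun ω => e ω * (ε ω * ε ω))
    (hbb : (fun ω => b ω - b' ω) =O[l] fun ω => e ω * (ε ω * ε ω)) :
    (fun ω => a ω / b ω - a' ω / b' ω) =O[l] e := by
  have hb' := isBigO_of_isBigO_sub he hb hbb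
  have ha' := ha.of_sub_left he.isBigO haa
  have hq : (fun ω => a' ω / b' ω) =O[l] fun _ => (1 : ℝ) :=
    IsBigO.div_of_mul (by simpa using ha'.trans hb')
  -- This is the numerator of `a / b - a' / b'` over the single denominator `b`.
  have hnum : (fun ω => (a ω - a' ω) - a' ω / b' ω * (b ω - b' ω)) =O[l]
      fun ω => e ω * (ε ω * ε ω) :=
    haa.sub ((hq.mul hbb).congr_right fun ω => by ring)
  have h1 := IsBigO.div_of_mul (hnum.trans ((isBigO_refl e l).mul hb))
  refine h1.congr' ?_ EventuallyEq.rfl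
  filter_upwards [hε, hb.eq_zero_imp, hb'.eq_zero_imp] with ω h0 h2 h3
  have h4 : b ω ≠ 0 := fun h => (mul_ne_zero h0 h0) (h2 h)
  have h5 : b' ω ≠ 0 := fun h => (mul_ne_zero h0 h0) (h3 h)
  field_simp
  ring

/-! ### Perturbation of truncated Gram–Schmidt sweeps. -/

section Sweep

variable {v q : Ω → ℕ → E} {s : Ω → ℕ} {w : Ω → E} {lo M : ℕ}

theorem gsCoeff_succ_of_le {v q : ℕ → E} {s lo : ℕ} {w : E} {j : ℕ} (h : lo ≤ j + 1) :
    gsCoeff v q s lo w (j + 1) = inner ℝ (v (s + (j + 1))) (gsSweep v q s lo w j) /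
      inner ℝ (v (s + (j + 1))) (q (s + (j + 1))) := by
  rw [gsCoeff, if_pos h]

theorem gsCoeff_of_lt {v q : ℕ → E} {s lo : ℕ} {w : E} {j : ℕ} (h : j < lo) :
    gsCoeff v q s lo w j = 0 := by
  cases j with
  | zero => rfl
  | succ j => rw [gsCoeff, if_neg (by omega)]

theorem gsSweep_succ {v q : ℕ → E} {s lo : ℕ} {w : E} {j : ℕ} :
    gsSweep v q s lo w (j + 1) =
      gsSweep v q s lo w j - gsCoeff v q s lo w (j + 1) • q (s + (j + 1)) := by
  rw [gsSweep, gsCoeff]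
  split_ifs <;> simp

/-- A sweep through well-conditioned directions is bounded. -/
theorem isBigO_gsSweep (hv : ∀ j, 1 ≤ j → j ≤ M → (fun ω => v ω (s ω + j)) =O[l] ε)
    (hq : ∀ j, 1 ≤ j → j ≤ M → (fun ω => q ω (s ω + j)) =O[l] ε)
    (hvq : ∀ j, 1 ≤ j → j ≤ M → (fun ω => ε ω * ε ω) =O[l]
      fun ω => (inner ℝ (v ω (s ω + j)) (q ω (s ω + j)) : ℝ))
    (hw : w =O[l] ε) : ∀ j ≤ M,
      (fun ω => gsSweep (v ω) (q ω) (s ω) lo (w ω) j) =O[l] ε ∧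
      (fun ω => gsCoeff (v ω) (q ω) (s ω) lo (w ω) j) =O[l] fun _ => (1 : ℝ) := by
  intro j
  induction j with
  | zero => exact fun _ => ⟨hw, isBigO_zero _ _⟩
  | succ j ih =>
    intro hj
    have ih := (ih (by omega)).1
    have hc : (fun ω => gsCoeff (v ω) (q ω) (s ω) lo (w ω) (j + 1)) =O[l] fun _ => (1 : ℝ) := by
      by_cases hlo : lo ≤ j + 1
      · simp only [gsCoeff_succ_of_le hlo]
        refine IsBigO.div_of_mul ?_
        simpa using ((hv (j + 1) (by omega) hj).real_inner ih).trans (hvq (j + 1) (by omega) hj)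
      · simp only [gsCoeff_of_lt (not_le.1 hlo)]
        exact isBigO_zero _ _
    refine ⟨?_, hc⟩
    simp only [gsSweep_succ]
    exact ih.sub (by simpa using hc.smul (hq (j + 1) (by omega) hj))

/-- A truncated sweep is close to the exact oblique projection along nearby biorthogonal
directions, provided the exact coefficients of the skipped directions vanish. -/
theorem isBigO_gsCoeff_sub {V Q : Ω → ℕ → E} {w' : Ω → E} {c : Ω → ℕ → ℝ}
    (he : e =o[l] fun _ => (1 : ℝ)) (hε : ∀ᶠ ω in l, ε ω ≠ 0)
    (hv : ∀ j, 1 ≤ j → j ≤ M → (fun ω => v ω (s ω + j)) =O[l] ε)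
    (hq : ∀ j, 1 ≤ j → j ≤ M → (fun ω => q ω (s ω + j)) =O[l] ε)
    (hvq : ∀ j, 1 ≤ j → j ≤ M → (fun ω => ε ω * ε ω) =O[l]
      fun ω => (inner ℝ (v ω (s ω + j)) (q ω (s ω + j)) : ℝ))
    (hw : w =O[l] ε)
    (hvV : ∀ j, 1 ≤ j → j ≤ M →
      (fun ω => v ω (s ω + j) - V ω j) =O[l] fun ω => e ω * ε ω)
    (hqQ : ∀ j, 1 ≤ j → j ≤ M →
      (fun ω => q ω (s ω + j) - Q ω j) =O[l] fun ω => e ω * ε ω)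
    (hww : (fun ω => w ω - w' ω) =O[l] fun ω => e ω * ε ω)
    (hVQ : ∀ ω, ∀ i ∈ Finset.Icc 1 M, ∀ j ∈ Finset.Icc 1 M, i ≠ j →
      inner ℝ (V ω i) (Q ω j) = 0)
    (horth : ∀ ω, ∀ i ∈ Finset.Icc 1 M,
      inner ℝ (V ω i) (w' ω - ∑ j ∈ Finset.Icc 1 M, c ω j • Q ω j) = 0)
    (hskip : ∀ j, 1 ≤ j → j ≤ M → j < lo → ∀ᶠ ω in l, c ω j = 0) : ∀ j ≤ M,
      (fun ω => gsSweep (v ω) (q ω) (s ω) lo (w ω) j -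
        (w' ω - ∑ i ∈ Finset.Icc 1 j, c ω i • Q ω i)) =O[l] (fun ω => e ω * ε ω) ∧
      (1 ≤ j → (fun ω => gsCoeff (v ω) (q ω) (s ω) lo (w ω) j - c ω j) =O[l] e) := by
  have hbd := isBigO_gsSweep (lo := lo) hv hq hvq hw
  intro j
  induction j with
  | zero => exact fun _ => ⟨by simpa [gsSweep] using hww, fun h => absurd h (by omega)⟩
  | succ j ih =>
    intro hj
    have ih := (ih (by omega)).1
    have hj1 : 1 ≤ j + 1 := by omega
    have hc : (fun ω => gsCoeff (v ω) (q ω) (s ω) lo (w ω) (j + 1) - c ω (j + 1)) =O[l] e := by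
      by_cases hlo : lo ≤ j + 1
      · have hnum := isBigO_inner_sub_inner he.isBigO (hv _ hj1 hj) (hbd j (by omega)).1
          (hvV _ hj1 hj) ih
        have hden := isBigO_inner_sub_inner he.isBigO (hv _ hj1 hj) (hq _ hj1 hj)
          (hvV _ hj1 hj) (hqQ _ hj1 hj)
        have hmain := isBigO_div_sub_div he hε ((hv _ hj1 hj).real_inner (hbd j (by omega)).1)
          (hvq _ hj1 hj) hnum hden
        have hden' := isBigO_of_isBigO_sub he (hvq _ hj1 hj) hden
        refine hmain.congr' ?_ EventuallyEq.rfl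
        filter_upwards [hε, hden'.eq_zero_imp] with ω h0 h1
        have h2 : inner ℝ (V ω (j + 1)) (Q ω (j + 1)) ≠ 0 := fun h => mul_ne_zero h0 h0 (h1 h)
        rw [gsCoeff_succ_of_le hlo]
        congr 1
        rw [div_eq_iff h2]
        have hmem : j + 1 ∈ Finset.Icc 1 M := Finset.mem_Icc.2 ⟨hj1, hj⟩
        -- By biorthogonality, the exact coefficient is the same whether it is computed from `w'` or
        -- from `w'` with the earlier projections already subtracted, as in the modified sweep.
        have h3 := horth ω (j + 1) hmem
        rw [inner_sub_right, inner_sum, Finset.sum_eq_single_of_mem (j + 1) hmem,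
          inner_smul_right] at h3
        · rw [inner_sub_right, inner_sum, Finset.sum_eq_zero]
          · linarith
          · intro i hi
            obtain ⟨h4, h5⟩ := Finset.mem_Icc.1 hi
            rw [inner_smul_right, hVQ ω _ hmem _ (Finset.mem_Icc.2 ⟨h4, by omega⟩) (by omega),
              mul_zero]
        · intro i hi hne
          rw [inner_smul_right, hVQ ω _ hmem _ hi (Ne.symm hne), mul_zero]
      · simp only [gsCoeff_of_lt (not_le.1 hlo)]
        refine (isBigO_zero e l).congr' ?_ EventuallyEq.rfl
        filter_upwards [hskip _ hj1 hj (not_le.1 hlo)] with ω h0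
        rw [h0, sub_zero]
    refine ⟨?_, fun _ => hc⟩
    have hsm := isBigO_smul_sub_smul he.isBigO (hbd (j + 1) hj).2 (hq _ hj1 hj) hc (hqQ _ hj1 hj)
    refine (ih.sub hsm).congr_left fun ω => ?_
    rw [gsSweep_succ, ← Finset.insert_Icc_right_eq_Icc_add_one hj1, Finset.sum_insert (by simp)]
    abel

end Sweep

end Asymptotics

/-! ### Data and exact identities of one cycle. -/

/-- A cycle of `M` steps of a run of the restarted method, together with the linearized process.
The parameters are those on which constants may depend. -/
structure CycleRun (d : ℕ) (t : AMType) (m : ℕ) (τ η β₀ β₁ τ₀ μ L : ℝ) (M : ℕ) where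
  g : EuclideanSpace ℝ (Fin d) → EuclideanSpace ℝ (Fin d)
  xs : EuclideanSpace ℝ (Fin d)
  ρ : ℝ
  κ : ℝ
  β : ℕ → ℝ
  x : ℕ → EuclideanSpace ℝ (Fin d)
  p : ℕ → EuclideanSpace ℝ (Fin d)
  q : ℕ → EuclideanSpace ℝ (Fin d)
  n : ℕ → ℕ
  x' : ℕ → EuclideanSpace ℝ (Fin d)
  p' : ℕ → EuclideanSpace ℝ (Fin d)
  q' : ℕ → EuclideanSpace ℝ (Fin d)
  ζ' : ℕ → ℕ → ℝ
  Γ' : ℕ → ℕ → ℝ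
  /-- the iteration at which the cycle starts -/
  s : ℕ
  ρ_pos : 0 < ρ
  κ_pos : 0 < κ
  loc : LocalConstants (fpDefect g) xs ρ κ μ L
  symm : (fderiv ℝ g xs).toLinearMap.IsSymmetric
  mixing : ∀ k, β₀ ≤ |β k| ∧ |β k| ≤ β₁
  run : IsRestartedSTAM t g β m τ η x p q n
  lin : IsLinearizedAM t (fderiv ℝ (fpDefect g) xs) xs β x n x' p' q' ζ' Γ'
  mem : ∀ i ≤ M, n (s + i) = i
  gap : ∀ i, 1 ≤ i → i < M → τ₀ ≤ |1 - stamGamma t g x p q n (s + i) i|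

/-- The operator `K` with `v_lᵀ y = ± ⟨p_l, K y⟩` for the test directions of a linear problem. -/
noncomputable def AMType.test {d : ℕ} (t : AMType)
    (A : EuclideanSpace ℝ (Fin d) →L[ℝ] EuclideanSpace ℝ (Fin d)) :
    EuclideanSpace ℝ (Fin d) →L[ℝ] EuclideanSpace ℝ (Fin d) :=
  match t with
  | .typeI => ContinuousLinearMap.id ℝ _
  | .typeII => A

theorem AMType.weight_apply {d : ℕ} (t : AMType)
    (A : EuclideanSpace ℝ (Fin d) →L[ℝ] EuclideanSpace ℝ (Fin d)) (y : EuclideanSpace ℝ (Fin d)) :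
    t.weight A y = t.test A (A y) := by
  cases t
  · rfl
  · simp [AMType.weight, AMType.test, pow_two]

/-- The sign in `v_lᵀ y = ± ⟨p_l, K y⟩`. -/
def AMType.sign (t : AMType) : ℝ :=
  match t with
  | .typeI => 1
  | .typeII => -1

theorem AMType.sign_ne_zero (t : AMType) : t.sign ≠ 0 := by
  cases t <;> simp [AMType.sign]

theorem AMType.abs_sign (t : AMType) : |t.sign| = 1 := by
  cases t <;> simp [AMType.sign]

theorem AMType.inner_dir {d : ℕ} (t : AMType)
    {A : EuclideanSpace ℝ (Fin d) →L[ℝ] EuclideanSpace ℝ (Fin d)}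
    (hA : ∀ x y, inner ℝ (A x) y = inner ℝ x (A y)) {p q : ℕ → EuclideanSpace ℝ (Fin d)} {j : ℕ}
    (h : q j = -A (p j)) (y : EuclideanSpace ℝ (Fin d)) :
    inner ℝ (t.dir p q j) y = t.sign * inner ℝ (p j) (t.test A y) := by
  cases t
  · simp [AMType.dir, AMType.sign, AMType.test]
  · simp [AMType.dir, AMType.sign, AMType.test, h, hA]

theorem AMType.inner_test_self_ge {d : ℕ} (t : AMType)
    {A : EuclideanSpace ℝ (Fin d) →L[ℝ] EuclideanSpace ℝ (Fin d)} {μ : ℝ} (hμ : 0 < μ)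
    (hA : ∀ x y, inner ℝ (A x) y = inner ℝ x (A y)) (hn : ∀ y, μ * ‖y‖ ≤ ‖A y‖)
    (hf : ∀ y, μ * ‖y‖ ^ 2 ≤ inner ℝ y (A y)) (y : EuclideanSpace ℝ (Fin d)) :
    min μ (μ ^ 2) * ‖y‖ ^ 2 ≤ inner ℝ y (t.test A (A y)) := by
  cases t
  · refine le_trans ?_ (hf y)
    gcongr
    exact min_le_left _ _
  · change _ ≤ inner ℝ y (A (A y))
    rw [← hA, real_inner_self_eq_norm_sq]
    calc min μ (μ ^ 2) * ‖y‖ ^ 2 ≤ μ ^ 2 * ‖y‖ ^ 2 := by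
          gcongr
          exact min_le_right _ _
      _ = (μ * ‖y‖) ^ 2 := by ring
      _ ≤ ‖A y‖ ^ 2 := by
          gcongr
          exact hn y

namespace CycleRun

variable {d : ℕ} {t : AMType} {m : ℕ} {τ η β₀ β₁ τ₀ μ L : ℝ} {M : ℕ}

section Exact

variable (ω : CycleRun d t m τ η β₀ β₁ τ₀ μ L M)

/-- The Jacobian of the defect at the solution. -/
noncomputable def A : EuclideanSpace ℝ (Fin d) →L[ℝ] EuclideanSpace ℝ (Fin d) :=
  fderiv ℝ (fpDefect ω.g) ω.xs

/-- The error of the `i`-th iterate of the cycle. -/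
def u (i : ℕ) : EuclideanSpace ℝ (Fin d) := ω.x (ω.s + i) - ω.xs

/-- The residual of the `i`-th iterate of the cycle. -/
def r (i : ℕ) : EuclideanSpace ℝ (Fin d) := ω.g (ω.x (ω.s + i)) - ω.x (ω.s + i)

/-- The test directions of the run. -/
def v : ℕ → EuclideanSpace ℝ (Fin d) := t.dir ω.p ω.q

/-- The error at the start of the cycle. -/
noncomputable def ε : ℝ := ‖ω.u 0‖

/-- The relative size of the nonlinearity at the start of the cycle. -/
noncomputable def e : ℝ := ω.κ * ω.ε

/-- The coefficients of the directions of the cycle. -/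
noncomputable def zeta (i j : ℕ) : ℝ :=
  gsCoeff ω.v ω.q ω.s (max 1 (i - 2)) (ω.r i - ω.r (i - 1)) j

/-- The mixing coefficients of the cycle. -/
noncomputable def gam (i j : ℕ) : ℝ := gsCoeff ω.v ω.q ω.s (max 1 (i - 1)) (ω.r i) j

/-- The error of the linearized process. -/
def U (i : ℕ) : EuclideanSpace ℝ (Fin d) := ω.x' (ω.s + i) - ω.xs

/-- The directions of the linearized process. -/
def P (i : ℕ) : EuclideanSpace ℝ (Fin d) := ω.p' (ω.s + i)

theorem ε_nonneg : 0 ≤ ω.ε := norm_nonneg _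

theorem e_nonneg : 0 ≤ ω.e := mul_nonneg ω.κ_pos.le ω.ε_nonneg

theorem enterMem_eq {i : ℕ} (hi : 1 ≤ i) (hi' : i ≤ M) : enterMem ω.n (ω.s + i) = i := by
  obtain ⟨i, rfl⟩ : ∃ i', i = i' + 1 := ⟨i - 1, by omega⟩
  change ω.n (ω.s + i) + 1 = _
  rw [ω.mem i (by omega)]

/-- Either test would have reset the memory to zero, whereas it equals `i ≥ 1`. The first failure
validates the formulas for `p` and `q`, the second is the curvature bound. -/
theorem not_restart {i : ℕ} (hi : 1 ≤ i) (hi' : i ≤ M) :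
    ¬ RestartTest ω.g m η ω.x ω.n (ω.s + i) ∧ ¬ CurvatureTest t τ ω.p ω.q ω.n (ω.s + i) := by
  classical
  have h := ω.run.mem (ω.s + i)
  rw [ω.mem i hi', ω.enterMem_eq hi hi'] at h
  split_ifs at h with h1 h2
  · omega
  · omega
  · exact ⟨h1, fun h3 => h2 ⟨by omega, h3⟩⟩

theorem stamZeta_eq {i : ℕ} (hi : 1 ≤ i) (hi' : i ≤ M) (j : ℕ) :
    stamZeta t ω.g ω.x ω.p ω.q ω.n (ω.s + i) j = ω.zeta i j := by
  have h1 : ω.s + i - 1 = ω.s + (i - 1) := by omega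
  rw [stamZeta, ω.enterMem_eq hi hi', Nat.add_sub_cancel, h1]
  rfl

theorem stamGamma_eq {i : ℕ} (hi' : i ≤ M) (j : ℕ) :
    stamGamma t ω.g ω.x ω.p ω.q ω.n (ω.s + i) j = ω.gam i j := by
  rw [stamGamma, ω.mem i hi', Nat.add_sub_cancel]
  rfl

theorem p_eq {i : ℕ} (hi : 1 ≤ i) (hi' : i ≤ M) : ω.p (ω.s + i) =
    (ω.u i - ω.u (i - 1)) - ∑ j ∈ Finset.Icc 1 (i - 1), ω.zeta i j • ω.p (ω.s + j) := by
  have h1 : ω.s + i - 1 = ω.s + (i - 1) := by omega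
  rw [ω.run.pair_p (ω.s + i) (by rw [ω.enterMem_eq hi hi']; omega) (ω.not_restart hi hi').1,
    ω.enterMem_eq hi hi', Nat.add_sub_cancel, h1]
  simp only [ω.stamZeta_eq hi hi', u]
  congr 1
  abel

theorem q_eq {i : ℕ} (hi : 1 ≤ i) (hi' : i ≤ M) : ω.q (ω.s + i) =
    (ω.r i - ω.r (i - 1)) - ∑ j ∈ Finset.Icc 1 (i - 1), ω.zeta i j • ω.q (ω.s + j) := by
  have h1 : ω.s + i - 1 = ω.s + (i - 1) := by omega
  rw [ω.run.pair_q (ω.s + i) (by rw [ω.enterMem_eq hi hi']; omega) (ω.not_restart hi hi').1,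
    ω.enterMem_eq hi hi', Nat.add_sub_cancel, h1]
  simp only [ω.stamZeta_eq hi hi', r]

theorem u_succ {i : ℕ} (hi : i ≤ M) : ω.u (i + 1) =
    (ω.u i - ∑ j ∈ Finset.Icc 1 i, ω.gam i j • ω.p (ω.s + j)) +
      ω.β (ω.s + i) • (ω.r i - ∑ j ∈ Finset.Icc 1 i, ω.gam i j • ω.q (ω.s + j)) := by
  rw [u, ← add_assoc, ω.run.update (ω.s + i), ω.mem i hi, Nat.add_sub_cancel]
  simp only [ω.stamGamma_eq hi, u, r]
  abel

theorem curvature {i : ℕ} (hi : 1 ≤ i) (hi' : i ≤ M) :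
    τ * |inner ℝ (ω.v (ω.s + 1)) (ω.q (ω.s + 1))| ≤
      |inner ℝ (ω.v (ω.s + i)) (ω.q (ω.s + i))| := by
  have h := (ω.not_restart hi hi').2
  rw [CurvatureTest, ω.enterMem_eq hi hi', Nat.add_sub_cancel, not_lt] at h
  exact h

theorem norm_A (y : EuclideanSpace ℝ (Fin d)) : μ * ‖y‖ ≤ ‖ω.A y‖ ∧ ‖ω.A y‖ ≤ L * ‖y‖ :=
  ω.loc.jacobian ω.xs (Metric.mem_closedBall_self ω.ρ_pos.le) y

theorem form_A (y : EuclideanSpace ℝ (Fin d)) : μ * ‖y‖ ^ 2 ≤ inner ℝ y (ω.A y) :=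
  (ω.loc.form ω.xs (Metric.mem_closedBall_self ω.ρ_pos.le) y).1

theorem symm_A (y z : EuclideanSpace ℝ (Fin d)) : inner ℝ (ω.A y) z = inner ℝ y (ω.A z) := by
  have hd := ω.loc.differentiable ω.xs (Metric.mem_closedBall_self ω.ρ_pos.le)
  have hg : ω.g = fun x => x - fpDefect ω.g x := by
    ext1 x
    simp [fpDefect]
  have h1 : fderiv ℝ ω.g ω.xs = ContinuousLinearMap.id ℝ _ - ω.A := by
    conv_lhs => rw [hg]
    rw [fderiv_fun_sub differentiableAt_fun_id hd, fderiv_fun_id]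
    rfl
  have h2 : ∀ y, ω.A y = y - fderiv ℝ ω.g ω.xs y := by
    intro y
    rw [h1]
    simp
  have h3 : inner ℝ (fderiv ℝ ω.g ω.xs y) z = inner ℝ y (fderiv ℝ ω.g ω.xs z) := ω.symm y z
  rw [h2, h2, inner_sub_left, inner_sub_right, h3]

theorem lin_r {i : ℕ} (hi : ‖ω.u i‖ ≤ ω.ρ) : ‖ω.r i + ω.A (ω.u i)‖ ≤ ω.κ * ‖ω.u i‖ ^ 2 := by
  have h1 := ω.loc.linearization (ω.x (ω.s + i)) (by rwa [mem_closedBall_iff_norm])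
  have h2 : ω.r i + ω.A (ω.u i) = -(fpDefect ω.g (ω.x (ω.s + i)) -
      fderiv ℝ (fpDefect ω.g) ω.xs (ω.x (ω.s + i) - ω.xs)) := by
    simp only [r, A, u, fpDefect]
    abel
  rw [h2, norm_neg]
  refine h1.trans ?_
  have h3 : (0 : ℝ) ≤ ‖ω.x (ω.s + i) - ω.xs‖ ^ 2 := by positivity
  have h4 := ω.κ_pos
  rw [u]
  nlinarith [mul_nonneg h4.le h3]

theorem U_zero : ω.U 0 = ω.u 0 := by
  rw [U, u, ω.lin.restart _ (ω.mem 0 (Nat.zero_le _))]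

theorem q'_eq {i : ℕ} (hi : 1 ≤ i) (hi' : i ≤ M) : ω.q' (ω.s + i) = -ω.A (ω.P i) := by
  induction i using Nat.strong_induction_on with
  | _ i ih =>
    have hn : ω.n (ω.s + i) ≠ 0 := by
      rw [ω.mem i hi']
      omega
    rw [P, ω.lin.pair_p _ hn, ω.lin.pair_q _ hn, ω.mem i hi', Nat.add_sub_cancel]
    have h1 : ∑ j ∈ Finset.Icc 1 (i - 1), ω.ζ' (ω.s + i) j • ω.q' (ω.s + j)
        = -ω.A (∑ j ∈ Finset.Icc 1 (i - 1), ω.ζ' (ω.s + i) j • ω.p' (ω.s + j)) := by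
      rw [map_sum, ← Finset.sum_neg_distrib]
      refine Finset.sum_congr rfl fun j hj => ?_
      obtain ⟨h2, h3⟩ := Finset.mem_Icc.1 hj
      rw [ih j (by omega) h2 (by omega), map_smul, smul_neg, P]
    rw [h1]
    simp only [map_sub, A]
    abel

theorem inner_dir' {i : ℕ} (hi : 1 ≤ i) (hi' : i ≤ M) (y : EuclideanSpace ℝ (Fin d)) :
    inner ℝ (t.dir ω.p' ω.q' (ω.s + i)) y = t.sign * inner ℝ (ω.P i) (t.test ω.A y) :=
  t.inner_dir ω.symm_A (ω.q'_eq hi hi') y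

/-- With `q̂ = -A p̂` the hatted process is expressed by `p̂` alone, and the two types differ only
in the choice of `K`. The sign of the test directions is irrelevant for orthogonality. -/
theorem linearCycle : LinearCycle ω.A (t.test ω.A) (fun j => ω.β (ω.s + j)) M ω.U ω.P
    (fun i j => ω.ζ' (ω.s + i) j) (fun i j => ω.Γ' (ω.s + i) j) where
  symm_A := ω.symm_A
  symm_K x y := by
    cases t
    · rfl
    · exact ω.symm_A x y
  comm x := by cases t <;> rfl
  step j hj hj' := by
    have h1 : ω.s + j - 1 = ω.s + (j - 1) := by omega
    rw [P, ω.lin.pair_p _ (by rw [ω.mem j hj']; omega), ω.mem j hj', Nat.add_sub_cancel, h1]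
    simp only [U, P]
    congr 1
    abel
  orth j hj l hl := by
    obtain ⟨h1, h2⟩ := Finset.mem_Icc.1 hl
    have h := ω.lin.pair_orth (ω.s + j) (by rw [ω.mem j hj]; omega) l (by rwa [ω.mem j hj])
    rw [ω.mem j hj, Nat.add_sub_cancel, ω.inner_dir' h1 (by omega),
      ω.q'_eq (by omega : 1 ≤ j) hj, map_neg, inner_neg_right] at h
    simpa [t.sign_ne_zero] using h
  mix j hj l hl := by
    obtain ⟨h1, h2⟩ := Finset.mem_Icc.1 hl
    have h := ω.lin.mix_orth (ω.s + j) l (by rwa [ω.mem j hj])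
    rw [ω.mem j hj, Nat.add_sub_cancel, ω.inner_dir' h1 (by omega)] at h
    have h3 := (mul_eq_zero.1 h).resolve_left t.sign_ne_zero
    rw [← h3]
    congr 2
    rw [sub_eq_add_neg, ← Finset.sum_neg_distrib]
    congr 1
    refine Finset.sum_congr rfl fun i hi => ?_
    obtain ⟨h4, h5⟩ := Finset.mem_Icc.1 hi
    rw [ω.q'_eq h4 (by omega), smul_neg, neg_neg]
  update j hj := by
    rw [U, ← add_assoc, ω.lin.update (ω.s + j) (by rw [add_assoc, ω.mem (j + 1) hj]; omega),
      ω.mem j hj.le, Nat.add_sub_cancel]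
    have h1 : ∑ l ∈ Finset.Icc 1 j, ω.Γ' (ω.s + j) l •
        (ω.p' (ω.s + l) + ω.β (ω.s + j) • ω.q' (ω.s + l)) =
        ∑ l ∈ Finset.Icc 1 j, ω.Γ' (ω.s + j) l • (ω.P l - ω.β (ω.s + j) • ω.A (ω.P l)) := by
      refine Finset.sum_congr rfl fun i hi => ?_
      obtain ⟨h4, h5⟩ := Finset.mem_Icc.1 hi
      rw [ω.q'_eq h4 (by omega), smul_neg, ← sub_eq_add_neg, P]
    rw [h1]
    simp only [U, A]
    abel

end Exact

end CycleRun

/-! ### A priori bounds along a cycle. -/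

namespace AMType

open Asymptotics

variable {Ω E : Type*} [NormedAddCommGroup E] (t : AMType) {l : Filter Ω} {f : Ω → ℝ}

theorem isBigO_dir {p q : Ω → ℕ → E} {j : Ω → ℕ} (hp : (fun ω => p ω (j ω)) =O[l] f)
    (hq : (fun ω => q ω (j ω)) =O[l] f) : (fun ω => t.dir (p ω) (q ω) (j ω)) =O[l] f := by
  cases t
  · exact hp
  · exact hq

theorem isBigO_dir_sub {p q p' q' : Ω → ℕ → E} {j j' : Ω → ℕ}
    (hp : (fun ω => p ω (j ω) - p' ω (j' ω)) =O[l] f)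
    (hq : (fun ω => q ω (j ω) - q' ω (j' ω)) =O[l] f) :
    (fun ω => t.dir (p ω) (q ω) (j ω) - t.dir (p' ω) (q' ω) (j' ω)) =O[l] f := by
  cases t
  · exact hp
  · exact hq

end AMType

namespace CycleRun

open Asymptotics

variable {d : ℕ} {t : AMType} {m : ℕ} {τ η β₀ β₁ τ₀ μ L : ℝ} {M : ℕ}

variable (d t m τ η β₀ β₁ τ₀ μ L M) in
/-- Cycles that start close to the solution, relative to the local constants. -/
noncomputable def small : Filter (CycleRun d t m τ η β₀ β₁ τ₀ μ L M) :=
  comap (fun ω => ω.e + ω.ε / ω.ρ) (𝓝 0)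

local notation "𝓡" => CycleRun d t m τ η β₀ β₁ τ₀ μ L M

local notation "𝓢" => small d t m τ η β₀ β₁ τ₀ μ L M

theorem tendsto_small : Tendsto (fun ω => ω.e + ω.ε / ω.ρ) 𝓢 (𝓝 0) := tendsto_comap

theorem ratio_nonneg (ω : 𝓡) : 0 ≤ ω.ε / ω.ρ :=
  div_nonneg ω.ε_nonneg ω.ρ_pos.le

theorem isLittleO_e : (fun ω => ω.e) =o[𝓢] fun _ => (1 : ℝ) := by
  rw [isLittleO_one_iff]
  refine squeeze_zero (fun ω => ω.e_nonneg) (fun ω => ?_) tendsto_small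
  linarith [ω.ratio_nonneg]

theorem tendsto_ratio : Tendsto (fun ω => ω.ε / ω.ρ) 𝓢 (𝓝 0) := by
  refine squeeze_zero (fun ω => ω.ratio_nonneg) (fun ω => ?_) tendsto_small
  linarith [ω.e_nonneg]

theorem isBigO_e_mul_ε : (fun ω => ω.e * ω.ε) =O[𝓢] fun ω => ω.ε := by
  simpa using isLittleO_e.isBigO.mul (isBigO_refl (fun ω => ω.ε) 𝓢)

/-- This is the reason for the summand `ε / ρ` in the filter: anything of order `ε` lies within the
radius where the local estimates hold. -/
theorem eventually_norm_le {y : 𝓡 → EuclideanSpace ℝ (Fin d)}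
    (hy : y =O[𝓢] fun ω => ω.ε) : ∀ᶠ ω in 𝓢, ‖y ω‖ ≤ ω.ρ := by
  obtain ⟨C, hC, hb⟩ := hy.exists_pos
  filter_upwards [hb.bound, tendsto_ratio.eventually_lt_const (inv_pos.2 hC)] with ω h1 h2
  rw [div_lt_iff₀ ω.ρ_pos, inv_mul_eq_div, lt_div_iff₀ hC] at h2
  rw [Real.norm_of_nonneg ω.ε_nonneg] at h1
  linarith

theorem isBigO_A {l : Filter (𝓡)}
    {y : 𝓡 → EuclideanSpace ℝ (Fin d)}
    {f : 𝓡 → ℝ}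
    (hy : y =O[l] f) : (fun ω => ω.A (y ω)) =O[l] f :=
  (IsBigO.of_bound L (Eventually.of_forall fun ω => (ω.norm_A (y ω)).2)).trans hy

theorem isBigO_lin {i : ℕ} (hu : (fun ω => ω.u i) =O[𝓢] fun ω => ω.ε) :
    (fun ω => ω.r i + ω.A (ω.u i)) =O[𝓢] fun ω => ω.e * ω.ε := by
  have h1 : (fun ω => ω.r i + ω.A (ω.u i)) =O[𝓢] fun ω => ω.κ * ‖ω.u i‖ ^ 2 := by
    refine IsBigO.of_bound 1 ?_
    filter_upwards [eventually_norm_le hu] with ω h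
    rw [one_mul, Real.norm_of_nonneg (mul_nonneg ω.κ_pos.le (sq_nonneg _))]
    exact ω.lin_r h
  have h2 := (isBigO_refl (fun ω : 𝓡 => ω.κ) 𝓢).mul
    (hu.norm_left.mul hu.norm_left)
  refine h1.trans (h2.congr (fun ω => ?_) fun ω => ?_)
  · ring
  · rw [e]
    ring

theorem isBigO_r {i : ℕ} (hu : (fun ω => ω.u i) =O[𝓢] fun ω => ω.ε) :
    (fun ω => ω.r i) =O[𝓢] fun ω => ω.ε := by
  have h := ((isBigO_lin hu).trans isBigO_e_mul_ε).sub (isBigO_A hu)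
  simpa using h

theorem isBigO_β (l : Filter (𝓡)) (i : ℕ) :
    (fun ω => ω.β (ω.s + i)) =O[l] fun _ => (1 : ℝ) := by
  refine IsBigO.of_bound β₁ (Eventually.of_forall fun ω => ?_)
  rw [norm_one, mul_one]
  exact (ω.mixing _).2

theorem isBigO_u_zero : (fun ω => ω.u 0) =O[𝓢] fun ω => ω.ε := by
  refine IsBigO.of_bound 1 (Eventually.of_forall fun ω => ?_)
  rw [one_mul, Real.norm_of_nonneg ω.ε_nonneg, ε]

theorem u_one_eq (ω : 𝓡) :
    ω.u 1 = ω.u 0 + ω.β ω.s • ω.r 0 := by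
  simpa using ω.u_succ (Nat.zero_le M)

theorem isBigO_u_one : (fun ω => ω.u 1) =O[𝓢] fun ω => ω.ε := by
  simp only [u_one_eq]
  refine isBigO_u_zero.add ?_
  simpa using (isBigO_β 𝓢 0).smul (isBigO_r isBigO_u_zero)

theorem isBigO_curvature_one (hβ₀ : 0 < β₀) (hμ : 0 < μ) (hM : 1 ≤ M) :
    (fun ω => ω.ε * ω.ε) =O[𝓢]
      fun ω => (inner ℝ (ω.v (ω.s + 1)) (ω.q (ω.s + 1)) : ℝ) := by
  -- The first direction is `β r_0`, and `P₁` is its linearization; the corresponding `q` is `-A P₁`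
  -- up to `O(e ε)`.
  let P₁ : 𝓡 → EuclideanSpace ℝ (Fin d) :=
    fun ω => -(ω.β ω.s • ω.A (ω.u 0))
  have hβ := isBigO_β (𝓢) 0
  have hp_eq : ∀ ω : 𝓡, ω.p (ω.s + 1) = ω.β ω.s • ω.r 0 := by
    intro ω
    rw [ω.p_eq le_rfl hM, u_one_eq]
    simp
  have hq_eq : ∀ ω : 𝓡, ω.q (ω.s + 1) = ω.r 1 - ω.r 0 := by
    intro ω
    rw [ω.q_eq le_rfl hM]
    simp
  have hp : (fun ω => ω.p (ω.s + 1)) =O[𝓢] fun ω => ω.ε := by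
    simp only [hp_eq]
    simpa using hβ.smul (isBigO_r isBigO_u_zero)
  have hq : (fun ω => ω.q (ω.s + 1)) =O[𝓢] fun ω => ω.ε := by
    simp only [hq_eq]
    exact (isBigO_r isBigO_u_one).sub (isBigO_r isBigO_u_zero)
  have hpP : (fun ω => ω.p (ω.s + 1) - P₁ ω) =O[𝓢] fun ω => ω.e * ω.ε := by
    have h := hβ.smul (isBigO_lin isBigO_u_zero)
    simp only [one_smul] at h
    refine h.congr_left fun ω => ?_
    simp only [hp_eq, P₁, smul_add, add_zero, sub_neg_eq_add]
  have hqQ : (fun ω => ω.q (ω.s + 1) - -ω.A (P₁ ω)) =O[𝓢] fun ω => ω.e * ω.ε := by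
    have h := ((isBigO_lin isBigO_u_one).sub (isBigO_lin isBigO_u_zero)).sub (isBigO_A hpP)
    refine h.congr_left fun ω => ?_
    simp only [hp_eq, hq_eq, u_one_eq, P₁, map_sub, map_add, map_neg, map_smul]
    abel
  -- Positive definiteness bounds the form below by `min μ (μ ^ 2) ‖P₁‖²` for both types, and `‖P₁‖
  -- ≥ β₀ μ ε`.
  have hlow : (fun ω => ω.ε * ω.ε) =O[𝓢] fun ω =>
      (inner ℝ (t.dir (fun _ => P₁ ω) (fun _ => -ω.A (P₁ ω)) 0) (-ω.A (P₁ ω)) : ℝ) := by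
    have hc : 0 < min μ (μ ^ 2) := lt_min hμ (by positivity)
    refine IsBigO.of_bound (min μ (μ ^ 2) * (β₀ * μ) ^ 2)⁻¹ (Eventually.of_forall fun ω => ?_)
    rw [t.inner_dir ω.symm_A rfl, map_neg, inner_neg_right, norm_mul, norm_mul, norm_neg, Real.norm_eq_abs,
      Real.norm_eq_abs, Real.norm_eq_abs, t.abs_sign, one_mul,
      abs_of_nonneg ω.ε_nonneg, inv_mul_eq_div,
      le_div_iff₀ (by positivity)]
    have h1 := t.inner_test_self_ge hμ ω.symm_A (fun y => (ω.norm_A y).1) ω.form_A (P₁ ω)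
    refine le_trans ?_ (h1.trans (le_abs_self _))
    have h2 : β₀ * μ * ω.ε ≤ ‖P₁ ω‖ := by
      simp only [P₁, norm_neg, norm_smul, Real.norm_eq_abs, ε]
      rw [mul_assoc]
      exact mul_le_mul (ω.mixing _).1 (ω.norm_A _).1 (by positivity) (abs_nonneg _)
    have h3 : (β₀ * μ * ω.ε) ^ 2 ≤ ‖P₁ ω‖ ^ 2 :=
      pow_le_pow_left₀ (mul_nonneg (by positivity) ω.ε_nonneg) h2 2
    calc ω.ε * ω.ε * (min μ (μ ^ 2) * (β₀ * μ) ^ 2)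
        = min μ (μ ^ 2) * (β₀ * μ * ω.ε) ^ 2 := by ring
      _ ≤ _ := by gcongr
  refine isBigO_of_isBigO_sub isLittleO_e hlow ?_
  have hv : (fun ω => ω.v (ω.s + 1)) =O[𝓢] fun ω => ω.ε := t.isBigO_dir hp hq
  have hvV : (fun ω => ω.v (ω.s + 1) - t.dir (fun _ => P₁ ω) (fun _ => -ω.A (P₁ ω)) 0) =O[𝓢]
      fun ω => ω.e * ω.ε :=
    t.isBigO_dir_sub (j' := fun _ => 0) (p' := fun ω _ => P₁ ω)
      (q' := fun ω _ => -ω.A (P₁ ω)) hpP hqQ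
  exact (isBigO_inner_sub_inner isLittleO_e.isBigO hv hq hvV hqQ).neg_left.congr_left
    fun ω => by ring

/-- The passed curvature test passes the bound for the first direction on to all later ones, at the
cost of a factor `τ⁻¹`. No bound on the later directions themselves is used, so there is no
circularity in `isBigO_aux`. -/
theorem isBigO_curvature (hτ : 0 < τ) (hβ₀ : 0 < β₀) (hμ : 0 < μ) {i : ℕ} (hi : 1 ≤ i)
    (hi' : i ≤ M) : (fun ω => ω.ε * ω.ε) =O[𝓢]
      fun ω => (inner ℝ (ω.v (ω.s + i)) (ω.q (ω.s + i)) : ℝ) := by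
  refine (isBigO_curvature_one hβ₀ hμ (by omega)).trans
    (IsBigO.of_bound τ⁻¹ (Eventually.of_forall fun ω => ?_))
  rw [inv_mul_eq_div, le_div_iff₀ hτ, mul_comm]
  exact ω.curvature hi hi'

/-- The coefficients of the directions are bounded if the preceding quantities are. -/
theorem isBigO_zeta (hτ : 0 < τ) (hβ₀ : 0 < β₀) (hμ : 0 < μ) {i : ℕ} (hi : i ≤ M)
    (hu : ∀ j ≤ i, (fun ω => ω.u j) =O[𝓢] fun ω => ω.ε)
    (hpq : ∀ j, 1 ≤ j → j < i → (fun ω => ω.p (ω.s + j)) =O[𝓢] (fun ω => ω.ε) ∧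
      (fun ω => ω.q (ω.s + j)) =O[𝓢] fun ω => ω.ε) {j : ℕ} (hj : j < i) :
    (fun ω => ω.zeta i j) =O[𝓢] fun _ => (1 : ℝ) :=
  (isBigO_gsSweep (Ω := 𝓡) (M := i - 1) (v := fun ω => ω.v) (q := fun ω => ω.q) (s := fun ω => ω.s)
    (w := fun ω => ω.r i - ω.r (i - 1))
    (fun j h1 h2 => t.isBigO_dir (hpq j h1 (by omega)).1 (hpq j h1 (by omega)).2)
    (fun j h1 h2 => (hpq j h1 (by omega)).2)
    (fun j h1 h2 => isBigO_curvature hτ hβ₀ hμ h1 (by omega))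
    ((isBigO_r (hu i le_rfl)).sub (isBigO_r (hu (i - 1) (by omega)))) j (by omega)).2

/-- The mixing coefficients are bounded if the preceding quantities are. -/
theorem isBigO_gam (hτ : 0 < τ) (hβ₀ : 0 < β₀) (hμ : 0 < μ) {i : ℕ} (hi : i ≤ M)
    (hu : (fun ω => ω.u i) =O[𝓢] fun ω => ω.ε)
    (hpq : ∀ j, 1 ≤ j → j ≤ i → (fun ω => ω.p (ω.s + j)) =O[𝓢] (fun ω => ω.ε) ∧
      (fun ω => ω.q (ω.s + j)) =O[𝓢] fun ω => ω.ε) {j : ℕ} (hj : j ≤ i) :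
    (fun ω => ω.gam i j) =O[𝓢] fun _ => (1 : ℝ) :=
  (isBigO_gsSweep (Ω := 𝓡) (M := i) (v := fun ω => ω.v) (q := fun ω => ω.q) (s := fun ω => ω.s)
    (w := fun ω => ω.r i)
    (fun j h1 h2 => t.isBigO_dir (hpq j h1 h2).1 (hpq j h1 h2).2)
    (fun j h1 h2 => (hpq j h1 h2).2)
    (fun j h1 h2 => isBigO_curvature hτ hβ₀ hμ h1 (by omega)) (isBigO_r hu) j hj).2

/-- A joint induction in the order of the algorithm: errors up to `i` bound `ζ`, hence the `i`-th
directions, hence `Γ`, hence the error at `i + 1`. It reaches `M + 1` so that it covers the iterate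
entering the next cycle. -/
theorem isBigO_aux (hτ : 0 < τ) (hβ₀ : 0 < β₀) (hμ : 0 < μ) (i : ℕ) (hi : i ≤ M + 1) :
    (∀ j ≤ i, (fun ω => ω.u j) =O[𝓢] fun ω => ω.ε) ∧
    (∀ j, 1 ≤ j → j < i → (fun ω => ω.p (ω.s + j)) =O[𝓢] (fun ω => ω.ε) ∧
      (fun ω => ω.q (ω.s + j)) =O[𝓢] fun ω => ω.ε) := by
  induction i with
  | zero =>
    refine ⟨fun j hj => ?_, fun j h1 h2 => absurd h2 (by omega)⟩
    obtain rfl : j = 0 := by omega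
    exact isBigO_u_zero
  | succ i ih =>
    obtain ⟨hu, hpq⟩ := ih (by omega)
    have hpq' : ∀ j, 1 ≤ j → j ≤ i → (fun ω => ω.p (ω.s + j)) =O[𝓢] (fun ω => ω.ε) ∧
        (fun ω => ω.q (ω.s + j)) =O[𝓢] fun ω => ω.ε := by
      intro j h1 h2
      rcases h2.lt_or_eq with h3 | rfl
      · exact hpq j h1 h3
      · have hz : ∀ l ∈ Finset.Icc 1 (j - 1),
            (fun ω => ω.zeta j l) =O[𝓢] fun _ => (1 : ℝ) := by
          intro l hl
          obtain ⟨h4, h5⟩ := Finset.mem_Icc.1 hl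
          exact isBigO_zeta hτ hβ₀ hμ (by omega) hu hpq (by omega)
        constructor
        · simp only [fun ω : 𝓡 =>
            ω.p_eq h1 (by omega : j ≤ M)]
          refine ((hu j le_rfl).sub (hu (j - 1) (by omega))).sub (IsBigO.fun_sum fun l hl => ?_)
          obtain ⟨h4, h5⟩ := Finset.mem_Icc.1 hl
          simpa using (hz l hl).smul (hpq l h4 (by omega)).1
        · simp only [fun ω : 𝓡 =>
            ω.q_eq h1 (by omega : j ≤ M)]
          refine ((isBigO_r (hu j le_rfl)).sub (isBigO_r (hu (j - 1) (by omega)))).sub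
            (IsBigO.fun_sum fun l hl => ?_)
          obtain ⟨h4, h5⟩ := Finset.mem_Icc.1 hl
          simpa using (hz l hl).smul (hpq l h4 (by omega)).2
    refine ⟨fun j hj => ?_, fun j h1 h2 => hpq' j h1 (by omega)⟩
    rcases hj.lt_or_eq with h3 | rfl
    · exact hu j (by omega)
    · simp only [fun ω : 𝓡 => ω.u_succ (by omega : i ≤ M)]
      have hg : ∀ l ∈ Finset.Icc 1 i,
          (fun ω => ω.gam i l) =O[𝓢] fun _ => (1 : ℝ) := fun l hl =>
        isBigO_gam hτ hβ₀ hμ (by omega) (hu i le_rfl) hpq' (Finset.mem_Icc.1 hl).2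
      have h4 : (fun ω => ω.r i - ∑ j ∈ Finset.Icc 1 i, ω.gam i j • ω.q (ω.s + j)) =O[𝓢]
          fun ω => ω.ε := by
        refine (isBigO_r (hu i le_rfl)).sub (IsBigO.fun_sum fun l hl => ?_)
        obtain ⟨h5, h6⟩ := Finset.mem_Icc.1 hl
        simpa using (hg l hl).smul (hpq' l h5 h6).2
      refine ((hu i le_rfl).sub (IsBigO.fun_sum fun l hl => ?_)).add
        (by simpa using (isBigO_β 𝓢 i).smul h4)
      obtain ⟨h5, h6⟩ := Finset.mem_Icc.1 hl
      simpa using (hg l hl).smul (hpq' l h5 h6).1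

theorem isBigO_u (hτ : 0 < τ) (hβ₀ : 0 < β₀) (hμ : 0 < μ) {i : ℕ} (hi : i ≤ M + 1) :
    (fun ω => ω.u i) =O[𝓢] fun ω => ω.ε :=
  (isBigO_aux hτ hβ₀ hμ i hi).1 i le_rfl

theorem isBigO_p (hτ : 0 < τ) (hβ₀ : 0 < β₀) (hμ : 0 < μ) {i : ℕ} (hi : 1 ≤ i) (hi' : i ≤ M) :
    (fun ω => ω.p (ω.s + i)) =O[𝓢] fun ω => ω.ε :=
  ((isBigO_aux hτ hβ₀ hμ (M + 1) le_rfl).2 i hi (by omega)).1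

theorem isBigO_q (hτ : 0 < τ) (hβ₀ : 0 < β₀) (hμ : 0 < μ) {i : ℕ} (hi : 1 ≤ i) (hi' : i ≤ M) :
    (fun ω => ω.q (ω.s + i)) =O[𝓢] fun ω => ω.ε :=
  ((isBigO_aux hτ hβ₀ hμ (M + 1) le_rfl).2 i hi (by omega)).2

theorem isBigO_v (hτ : 0 < τ) (hβ₀ : 0 < β₀) (hμ : 0 < μ) {i : ℕ} (hi : 1 ≤ i) (hi' : i ≤ M) :
    (fun ω => ω.v (ω.s + i)) =O[𝓢] fun ω => ω.ε :=
  t.isBigO_dir (isBigO_p hτ hβ₀ hμ hi hi') (isBigO_q hτ hβ₀ hμ hi hi')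

end CycleRun

/-! ### Comparison of the run with the linearized process. -/

namespace CycleRun

open Asymptotics

variable {d : ℕ} {t : AMType} {m : ℕ} {τ η β₀ β₁ τ₀ μ L : ℝ} {M : ℕ}

variable (d t m τ η β₀ β₁ τ₀ μ L M) in
/-- Cycles that start close to the solution, but not at the solution. -/
noncomputable def smallPos : Filter (CycleRun d t m τ η β₀ β₁ τ₀ μ L M) :=
  small d t m τ η β₀ β₁ τ₀ μ L M ⊓ 𝓟 {ω | ω.ε ≠ 0}

local notation "𝓡" => CycleRun d t m τ η β₀ β₁ τ₀ μ L M

local notation "𝓢" => small d t m τ η β₀ β₁ τ₀ μ L M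

local notation "𝓣" => smallPos d t m τ η β₀ β₁ τ₀ μ L M

theorem smallPos_le : 𝓣 ≤ 𝓢 := inf_le_left

/-- With `ε ≠ 0`, lower bounds of order `ε²` make denominators nonzero. The a priori bounds did
without this, and so also hold for cycles started at the solution. -/
theorem eventually_ε_ne : ∀ᶠ ω in 𝓣, ω.ε ≠ 0 :=
  mem_inf_of_right (mem_principal_self _)

theorem isLittleO_e_pos : (fun ω => ω.e) =o[𝓣] fun _ => (1 : ℝ) := isLittleO_e.mono smallPos_le

variable (d t m τ η β₀ β₁ τ₀ μ L M) in
/-- Up to step `i`, the linearized process is close to the run. -/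
structure Close (i : ℕ) : Prop where
  u : ∀ j ≤ i, (fun ω => ω.u j - ω.U j) =O[𝓣] fun ω => ω.e * ω.ε
  p : ∀ j, 1 ≤ j → j < i → (fun ω => ω.p (ω.s + j) - ω.P j) =O[𝓣] fun ω => ω.e * ω.ε
  q : ∀ j, 1 ≤ j → j < i →
    (fun ω => ω.q (ω.s + j) - ω.q' (ω.s + j)) =O[𝓣] fun ω => ω.e * ω.ε
  gam : ∀ j, 1 ≤ j → j < i → ∀ l, 1 ≤ l → l ≤ j →
    (fun ω => ω.gam j l - ω.Γ' (ω.s + j) l) =O[𝓣] fun ω => ω.e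
  zeta : ∀ j < i, ∀ l, 1 ≤ l → l < j →
    (fun ω => ω.zeta j l - ω.ζ' (ω.s + j) l) =O[𝓣] fun ω => ω.e

local notation "𝓒" => Close d t m τ η β₀ β₁ τ₀ μ L M

theorem isBigO_r_sub {i : ℕ} (hτ : 0 < τ) (hβ₀ : 0 < β₀) (hμ : 0 < μ) (hi : i ≤ M)
    (h : (fun ω => ω.u i - ω.U i) =O[𝓣] fun ω => ω.e * ω.ε) :
    (fun ω => ω.r i - -ω.A (ω.U i)) =O[𝓣] fun ω => ω.e * ω.ε := by
  have hle : 𝓣 ≤ 𝓢 := smallPos_le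
  have h1 := (isBigO_lin (isBigO_u hτ hβ₀ hμ (by omega : i ≤ M + 1))).mono hle
  refine (h1.sub (isBigO_A h)).congr_left fun ω => ?_
  rw [map_sub]
  abel

theorem isBigO_form (hτ : 0 < τ) (hβ₀ : 0 < β₀) (hμ : 0 < μ) {j : ℕ} (hj : 1 ≤ j) (hj' : j ≤ M)
    (hp : (fun ω => ω.p (ω.s + j) - ω.P j) =O[𝓣] fun ω => ω.e * ω.ε)
    (hq : (fun ω => ω.q (ω.s + j) - ω.q' (ω.s + j)) =O[𝓣] fun ω => ω.e * ω.ε) :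
    (fun ω => ω.ε * ω.ε) =O[𝓣] fun ω => (inner ℝ (ω.P j) (t.test ω.A (ω.A (ω.P j))) : ℝ) := by
  have hle : 𝓣 ≤ 𝓢 := smallPos_le
  have hv := (isBigO_v hτ hβ₀ hμ hj hj').mono hle
  have hvV : (fun ω => ω.v (ω.s + j) - t.dir ω.p' ω.q' (ω.s + j)) =O[𝓣]
      fun ω => ω.e * ω.ε := t.isBigO_dir_sub hp hq
  have h1 := isBigO_inner_sub_inner isLittleO_e_pos.isBigO hv
    ((isBigO_q hτ hβ₀ hμ hj hj').mono hle) hvV hq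
  refine (isBigO_of_isBigO_sub isLittleO_e_pos
    ((isBigO_curvature hτ hβ₀ hμ hj hj').mono hle) h1).trans (isBigO_of_le _ fun ω => ?_)
  rw [ω.inner_dir' hj hj', ω.q'_eq hj hj', map_neg, inner_neg_right, norm_mul, norm_neg,
    Real.norm_eq_abs t.sign, t.abs_sign, one_mul]

theorem eventually_form_pos (hτ : 0 < τ) (hβ₀ : 0 < β₀) (hμ : 0 < μ) {j : ℕ} (hj : 1 ≤ j)
    (hj' : j ≤ M)
    (hp : (fun ω => ω.p (ω.s + j) - ω.P j) =O[𝓣] fun ω => ω.e * ω.ε)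
    (hq : (fun ω => ω.q (ω.s + j) - ω.q' (ω.s + j)) =O[𝓣] fun ω => ω.e * ω.ε) :
    ∀ᶠ ω in 𝓣, 0 < (inner ℝ (ω.P j) (t.test ω.A (ω.A (ω.P j))) : ℝ) := by
  filter_upwards [(isBigO_form hτ hβ₀ hμ hj hj' hp hq).eq_zero_imp, eventually_ε_ne] with ω h1 h2
  refine lt_of_le_of_ne ?_ fun h => mul_ne_zero h2 h2 (h1 h.symm)
  refine le_trans ?_ (t.inner_test_self_ge hμ ω.symm_A (fun y => (ω.norm_A y).1) ω.form_A _)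
  positivity

/-- The gap is assumed for the run only; closeness of the coefficients transfers half of it to the
linear process. -/
theorem eventually_ne_one (hτ₀ : 0 < τ₀) {j : ℕ} (hj : 1 ≤ j) (hj' : j < M)
    (hg : (fun ω => ω.gam j j - ω.Γ' (ω.s + j) j) =O[𝓣] fun ω => ω.e) :
    ∀ᶠ ω in 𝓣, τ₀ / 2 ≤ |1 - ω.Γ' (ω.s + j) j| := by
  have h1 := (hg.trans_isLittleO isLittleO_e_pos).bound (half_pos hτ₀)
  filter_upwards [h1] with ω h2
  have h3 := ω.gap j hj hj'
  rw [ω.stamGamma_eq hj'.le] at h3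
  rw [norm_one, mul_one, Real.norm_eq_abs] at h2
  have h4 : 1 - ω.gam j j = (1 - ω.Γ' (ω.s + j) j) - (ω.gam j j - ω.Γ' (ω.s + j) j) := by ring
  rw [h4] at h3
  linarith [abs_sub (1 - ω.Γ' (ω.s + j) j) (ω.gam j j - ω.Γ' (ω.s + j) j)]

namespace Close

theorem eventually_form_ne (hτ : 0 < τ) (hβ₀ : 0 < β₀) (hμ : 0 < μ) {i : ℕ} (h : 𝓒 i)
    (hi : i ≤ M) {l : ℕ} (hl : l < i) : ∀ᶠ ω in 𝓣,
      ∀ j ∈ Finset.Icc 1 l, (inner ℝ (ω.P j) (t.test ω.A (ω.A (ω.P j))) : ℝ) ≠ 0 := by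
  rw [Filter.eventually_all_finset]
  intro j hj
  obtain ⟨h1, h2⟩ := Finset.mem_Icc.1 hj
  filter_upwards [eventually_form_pos hτ hβ₀ hμ h1 (by omega) (h.p j h1 (by omega))
    (h.q j h1 (by omega))] with ω h3
  exact h3.ne'

theorem eventually_gam_ne (hτ₀ : 0 < τ₀) {i : ℕ} (h : 𝓒 i)
    (hi : i ≤ M) {l : ℕ} (hl : 1 ≤ l) (hli : l < i) : ∀ᶠ ω in 𝓣, ω.Γ' (ω.s + l) l ≠ 1 := by
  filter_upwards [eventually_ne_one hτ₀ hl (by omega) (h.gam l hl hli l hl le_rfl)] with ω h1 h2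
  rw [h2, sub_self, abs_zero] at h1
  linarith

end Close

theorem β_ne_zero (hβ₀ : 0 < β₀) (ω : 𝓡) (j : ℕ) : ω.β j ≠ 0 := by
  have := (ω.mixing j).1
  exact abs_pos.1 (by linarith)

theorem inner_dir_q'_eq_zero (ω : 𝓡) {i j : ℕ} (hi : 1 ≤ i) (hi' : i ≤ M) (hj : 1 ≤ j)
    (hj' : j ≤ M) (hij : i ≠ j) :
    inner ℝ (t.dir ω.p' ω.q' (ω.s + i)) (ω.q' (ω.s + j)) = 0 := by
  rw [ω.inner_dir' hi hi', ω.q'_eq hj hj', map_neg, inner_neg_right,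
    ω.linearCycle.form_eq_zero hi hi' hj hj' hij, neg_zero, mul_zero]

theorem Close.isBigO_zeta_sub (hτ : 0 < τ) (hβ₀ : 0 < β₀) (hμ : 0 < μ) (hτ₀ : 0 < τ₀) {i : ℕ}
    (h : 𝓒 i) (hi : i ≤ M) {l : ℕ} (hl : 1 ≤ l) (hli : l < i) :
    (fun ω => ω.zeta i l - ω.ζ' (ω.s + i) l) =O[𝓣] fun ω => ω.e := by
  have hle : 𝓣 ≤ 𝓢 := smallPos_le
  refine (isBigO_gsCoeff_sub (Ω := 𝓡) (M := i - 1) (v := fun ω => ω.v) (q := fun ω => ω.q)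
    (s := fun ω => ω.s) (w := fun ω => ω.r i - ω.r (i - 1)) (ε := fun ω => ω.ε)
    (lo := max 1 (i - 2))
    (V := fun ω j => t.dir ω.p' ω.q' (ω.s + j)) (Q := fun ω j => ω.q' (ω.s + j))
    (w' := fun ω => -ω.A (ω.U i) - -ω.A (ω.U (i - 1))) (c := fun ω j => ω.ζ' (ω.s + i) j)
    isLittleO_e_pos eventually_ε_ne ?_ ?_ ?_ ?_ ?_ ?_ ?_ ?_ ?_ ?_ l (by omega)).2 hl
  · exact fun j h1 h2 => (isBigO_v hτ hβ₀ hμ h1 (by omega)).mono hle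
  · exact fun j h1 h2 => (isBigO_q hτ hβ₀ hμ h1 (by omega)).mono hle
  · exact fun j h1 h2 => (isBigO_curvature hτ hβ₀ hμ h1 (by omega)).mono hle
  · exact ((isBigO_r (isBigO_u hτ hβ₀ hμ (by omega))).sub
      (isBigO_r (isBigO_u hτ hβ₀ hμ (by omega)))).mono hle
  · exact fun j h1 h2 => t.isBigO_dir_sub (h.p j h1 (by omega)) (h.q j h1 (by omega))
  · exact fun j h1 h2 => h.q j h1 (by omega)
  · have h1 := (isBigO_r_sub hτ hβ₀ hμ hi (h.u i le_rfl)).sub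
      (isBigO_r_sub hτ hβ₀ hμ (by omega) (h.u (i - 1) (by omega)))
    refine h1.congr_left fun ω => ?_
    abel
  · intro ω a ha b hb hab
    obtain ⟨h1, h2⟩ := Finset.mem_Icc.1 ha
    obtain ⟨h3, h4⟩ := Finset.mem_Icc.1 hb
    exact ω.inner_dir_q'_eq_zero h1 (by omega) h3 (by omega) hab
  · intro ω a ha
    have hn : ω.n (ω.s + i) ≠ 0 := by
      rw [ω.mem i hi]
      omega
    have h1 := ω.lin.pair_orth _ hn a (by rwa [ω.mem i hi])
    have h2 : ω.s + i - 1 = ω.s + (i - 1) := by omega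
    rw [ω.lin.pair_q _ hn, ω.mem i hi, Nat.add_sub_cancel, h2] at h1
    exact h1
  -- A skipped index satisfies `j + 2 < i`. The linear process is already known to be nondegenerate
  -- up to `j`, so its exact coefficient vanishes there.
  · intro j h1 h2 h3
    have h4 : j + 2 < i := by omega
    filter_upwards [h.eventually_form_ne hτ hβ₀ hμ hi (by omega : j < i),
      h.eventually_gam_ne hτ₀ hi h1 (by omega)] with ω h5 h6
    exact ω.linearCycle.stepCoeff_eq_zero (fun j => ω.β_ne_zero hβ₀ _) hi h1 h4 h5 h6

theorem Close.isBigO_pq_sub (hτ : 0 < τ) (hβ₀ : 0 < β₀) (hμ : 0 < μ) (hτ₀ : 0 < τ₀) {i : ℕ}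
    (h : 𝓒 i) (hi : 1 ≤ i) (hi' : i ≤ M) :
    (fun ω => ω.p (ω.s + i) - ω.P i) =O[𝓣] (fun ω => ω.e * ω.ε) ∧
    (fun ω => ω.q (ω.s + i) - ω.q' (ω.s + i)) =O[𝓣] fun ω => ω.e * ω.ε := by
  have hle : 𝓣 ≤ 𝓢 := smallPos_le
  have hzb : ∀ l, l < i → (fun ω => ω.zeta i l) =O[𝓣] fun _ => (1 : ℝ) := fun l hl =>
    (isBigO_zeta hτ hβ₀ hμ hi' (fun j hj => isBigO_u hτ hβ₀ hμ (by omega))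
      (fun j h1 h2 => ⟨isBigO_p hτ hβ₀ hμ h1 (by omega), isBigO_q hτ hβ₀ hμ h1 (by omega)⟩)
      hl).mono hle
  have hn : ∀ ω : 𝓡, ω.n (ω.s + i) ≠ 0 := by
    intro ω
    rw [ω.mem i hi']
    omega
  have hs : ∀ ω : 𝓡, ω.s + i - 1 = ω.s + (i - 1) := fun ω => by omega
  constructor
  · have h1 := ((h.u i le_rfl).sub (h.u (i - 1) (by omega))).sub
      (IsBigO.fun_sum (s := Finset.Icc 1 (i - 1)) fun l hl =>
        isBigO_smul_sub_smul isLittleO_e_pos.isBigO (hzb l (by have := Finset.mem_Icc.1 hl; omega))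
        ((isBigO_p hτ hβ₀ hμ (Finset.mem_Icc.1 hl).1
          (by have := Finset.mem_Icc.1 hl; omega)).mono hle)
        (h.isBigO_zeta_sub hτ hβ₀ hμ hτ₀ hi' (Finset.mem_Icc.1 hl).1
          (by have := Finset.mem_Icc.1 hl; omega))
        (h.p l (Finset.mem_Icc.1 hl).1 (by have := Finset.mem_Icc.1 hl; omega)))
    refine h1.congr_left fun ω => ?_
    rw [ω.p_eq hi hi', ω.linearCycle.step i hi hi', Finset.sum_sub_distrib]
    abel
  · have h1 := ((isBigO_r_sub hτ hβ₀ hμ hi' (h.u i le_rfl)).sub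
      (isBigO_r_sub hτ hβ₀ hμ (by omega) (h.u (i - 1) (by omega)))).sub
      (IsBigO.fun_sum (s := Finset.Icc 1 (i - 1)) fun l hl =>
        isBigO_smul_sub_smul isLittleO_e_pos.isBigO (hzb l (by have := Finset.mem_Icc.1 hl; omega))
        ((isBigO_q hτ hβ₀ hμ (Finset.mem_Icc.1 hl).1
          (by have := Finset.mem_Icc.1 hl; omega)).mono hle)
        (h.isBigO_zeta_sub hτ hβ₀ hμ hτ₀ hi' (Finset.mem_Icc.1 hl).1
          (by have := Finset.mem_Icc.1 hl; omega))
        (h.q l (Finset.mem_Icc.1 hl).1 (by have := Finset.mem_Icc.1 hl; omega)))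
    refine h1.congr_left fun ω => ?_
    rw [ω.q_eq hi hi', ω.lin.pair_q _ (hn ω), ω.mem i hi', Nat.add_sub_cancel, hs,
      Finset.sum_sub_distrib]
    simp only [U, A]
    abel

theorem Close.isBigO_gam_sub (hτ : 0 < τ) (hβ₀ : 0 < β₀) (hμ : 0 < μ) (hτ₀ : 0 < τ₀) {i : ℕ}
    (h : 𝓒 i) (hi : i ≤ M)
    (hpq : ∀ j, 1 ≤ j → j ≤ i →
      (fun ω => ω.p (ω.s + j) - ω.P j) =O[𝓣] (fun ω => ω.e * ω.ε) ∧
      (fun ω => ω.q (ω.s + j) - ω.q' (ω.s + j)) =O[𝓣] fun ω => ω.e * ω.ε)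
    {l : ℕ} (hl : 1 ≤ l) (hli : l ≤ i) :
    (fun ω => ω.gam i l - ω.Γ' (ω.s + i) l) =O[𝓣] fun ω => ω.e := by
  have hle : 𝓣 ≤ 𝓢 := smallPos_le
  refine (isBigO_gsCoeff_sub (Ω := 𝓡) (M := i) (v := fun ω => ω.v) (q := fun ω => ω.q)
    (s := fun ω => ω.s) (w := fun ω => ω.r i) (ε := fun ω => ω.ε)
    (lo := max 1 (i - 1))
    (V := fun ω j => t.dir ω.p' ω.q' (ω.s + j)) (Q := fun ω j => ω.q' (ω.s + j))
    (w' := fun ω => -ω.A (ω.U i)) (c := fun ω j => ω.Γ' (ω.s + i) j)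
    isLittleO_e_pos eventually_ε_ne ?_ ?_ ?_ ?_ ?_ ?_ ?_ ?_ ?_ ?_ l (by omega)).2 hl
  · exact fun j h1 h2 => (isBigO_v hτ hβ₀ hμ h1 (by omega)).mono hle
  · exact fun j h1 h2 => (isBigO_q hτ hβ₀ hμ h1 (by omega)).mono hle
  · exact fun j h1 h2 => (isBigO_curvature hτ hβ₀ hμ h1 (by omega)).mono hle
  · exact (isBigO_r (isBigO_u hτ hβ₀ hμ (by omega))).mono hle
  · exact fun j h1 h2 => t.isBigO_dir_sub (hpq j h1 h2).1 (hpq j h1 h2).2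
  · exact fun j h1 h2 => (hpq j h1 h2).2
  · exact isBigO_r_sub hτ hβ₀ hμ hi (h.u i le_rfl)
  · intro ω a ha b hb hab
    obtain ⟨h1, h2⟩ := Finset.mem_Icc.1 ha
    obtain ⟨h3, h4⟩ := Finset.mem_Icc.1 hb
    exact ω.inner_dir_q'_eq_zero h1 (by omega) h3 (by omega) hab
  · intro ω a ha
    have h1 := ω.lin.mix_orth (ω.s + i) a (by rwa [ω.mem i hi])
    rw [ω.mem i hi, Nat.add_sub_cancel] at h1
    exact h1
  · intro j h1 h2 h3
    have h4 : j + 1 < i := by omega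
    filter_upwards [h.eventually_form_ne hτ hβ₀ hμ hi (by omega : j < i),
      h.eventually_gam_ne hτ₀ hi h1 (by omega)] with ω h5 h6
    exact ω.linearCycle.mixCoeff_eq_zero (fun j => ω.β_ne_zero hβ₀ _) hi h1 h4 h5 h6

/-- Closeness propagates in the order `ζ`, then `p` and `q`, then `Γ`, then the next error, using
boundedness of the corresponding quantities of the run at each product. -/
theorem Close.succ (hτ : 0 < τ) (hβ₀ : 0 < β₀) (hμ : 0 < μ) (hτ₀ : 0 < τ₀) {i : ℕ}
    (h : 𝓒 i) (hi : i < M) : 𝓒 (i + 1) := by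
  have hle : 𝓣 ≤ 𝓢 := smallPos_le
  have hpq : ∀ j, 1 ≤ j → j ≤ i →
      (fun ω => ω.p (ω.s + j) - ω.P j) =O[𝓣] (fun ω => ω.e * ω.ε) ∧
      (fun ω => ω.q (ω.s + j) - ω.q' (ω.s + j)) =O[𝓣] fun ω => ω.e * ω.ε := by
    intro j h1 h2
    rcases h2.lt_or_eq with h3 | rfl
    · exact ⟨h.p j h1 h3, h.q j h1 h3⟩
    · exact h.isBigO_pq_sub hτ hβ₀ hμ hτ₀ h1 hi.le
  have hgam : ∀ l, 1 ≤ l → l ≤ i →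
      (fun ω => ω.gam i l - ω.Γ' (ω.s + i) l) =O[𝓣] fun ω => ω.e := fun l h1 h2 =>
    h.isBigO_gam_sub hτ hβ₀ hμ hτ₀ hi.le hpq h1 h2
  have hgb : ∀ l, l ≤ i → (fun ω => ω.gam i l) =O[𝓣] fun _ => (1 : ℝ) := fun l hl =>
    (isBigO_gam hτ hβ₀ hμ hi.le (isBigO_u hτ hβ₀ hμ (by omega))
      (fun j h1 h2 => ⟨isBigO_p hτ hβ₀ hμ h1 (by omega), isBigO_q hτ hβ₀ hμ h1 (by omega)⟩)
      hl).mono hle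
  refine ⟨fun j hj => ?_, fun j h1 h2 => (hpq j h1 (by omega)).1,
    fun j h1 h2 => (hpq j h1 (by omega)).2, fun j h1 h2 l h3 h4 => ?_, fun j h1 l h3 h4 => ?_⟩
  · rcases hj.lt_or_eq with h3 | rfl
    · exact h.u j (by omega)
    · have hsp := IsBigO.fun_sum (s := Finset.Icc 1 i) fun l hl =>
        isBigO_smul_sub_smul isLittleO_e_pos.isBigO (hgb l (Finset.mem_Icc.1 hl).2)
        ((isBigO_p hτ hβ₀ hμ (Finset.mem_Icc.1 hl).1
          (by have := Finset.mem_Icc.1 hl; omega)).mono hle)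
        (hgam l (Finset.mem_Icc.1 hl).1 (Finset.mem_Icc.1 hl).2)
        (hpq l (Finset.mem_Icc.1 hl).1 (Finset.mem_Icc.1 hl).2).1
      have hsq := IsBigO.fun_sum (s := Finset.Icc 1 i) fun l hl =>
        isBigO_smul_sub_smul isLittleO_e_pos.isBigO (hgb l (Finset.mem_Icc.1 hl).2)
        ((isBigO_q hτ hβ₀ hμ (Finset.mem_Icc.1 hl).1
          (by have := Finset.mem_Icc.1 hl; omega)).mono hle)
        (hgam l (Finset.mem_Icc.1 hl).1 (Finset.mem_Icc.1 hl).2)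
        (hpq l (Finset.mem_Icc.1 hl).1 (Finset.mem_Icc.1 hl).2).2
      have hmix := (isBigO_β (𝓣) i).smul
        ((isBigO_r_sub hτ hβ₀ hμ hi.le (h.u i le_rfl)).sub hsq)
      simp only [one_smul] at hmix
      refine (((h.u i le_rfl).sub hsp).add hmix).congr_left fun ω => ?_
      have hU : ω.U (i + 1) = (ω.U i - ∑ l ∈ Finset.Icc 1 i, ω.Γ' (ω.s + i) l • ω.P l) +
          ω.β (ω.s + i) • (-ω.A (ω.U i) -
            ∑ l ∈ Finset.Icc 1 i, ω.Γ' (ω.s + i) l • ω.q' (ω.s + l)) := by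
        rw [ω.linearCycle.update i hi]
        have h1 : ∑ l ∈ Finset.Icc 1 i, ω.Γ' (ω.s + i) l • ω.q' (ω.s + l) =
            -∑ l ∈ Finset.Icc 1 i, ω.Γ' (ω.s + i) l • ω.A (ω.P l) := by
          rw [← Finset.sum_neg_distrib]
          refine Finset.sum_congr rfl fun l hl => ?_
          obtain ⟨h4, h5⟩ := Finset.mem_Icc.1 hl
          rw [ω.q'_eq h4 (by omega), smul_neg]
        rw [h1]
        simp only [smul_sub, Finset.sum_sub_distrib, Finset.smul_sum, smul_neg, sub_neg_eq_add,
          smul_add, smul_comm (ω.β (ω.s + i))]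
        abel
      rw [ω.u_succ hi.le, hU]
      simp only [Finset.sum_sub_distrib, smul_sub]
      abel
  · rcases (Nat.lt_succ_iff.1 h2).lt_or_eq with h5 | rfl
    · exact h.gam j h1 h5 l h3 h4
    · exact hgam l h3 h4
  · rcases (Nat.lt_succ_iff.1 h1).lt_or_eq with h5 | rfl
    · exact h.zeta j h5 l h3 h4
    · exact h.isBigO_zeta_sub hτ hβ₀ hμ hτ₀ hi.le h3 h4

/-- The linearized process stays close to the run during a whole cycle. -/
theorem close (hτ : 0 < τ) (hβ₀ : 0 < β₀) (hμ : 0 < μ) (hτ₀ : 0 < τ₀) {i : ℕ} (hi : i ≤ M) :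
    𝓒 i := by
  induction i with
  | zero =>
    refine ⟨fun j hj => ?_, fun j h1 h2 => absurd h2 (by omega), fun j h1 h2 => absurd h2 (by omega),
      fun j h1 h2 => absurd h2 (by omega), fun j h1 => absurd h1 (by omega)⟩
    obtain rfl : j = 0 := by omega
    simp only [U_zero, sub_self]
    exact isBigO_zero _ _
  | succ i ih => exact (ih (by omega)).succ hτ hβ₀ hμ hτ₀ (by omega)

end CycleRun

/-! ### Comparison of the tridiagonal matrices and their spectra. -/

theorem tridiagEntry_congr {b φ φ' γ γ' : ℕ → ℝ} {N a c : ℕ} (hc : c < N)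
    (hφ : ∀ j ≤ N, φ j = φ' j) (hγ : ∀ j ≤ N, γ j = γ' j) :
    tridiagEntry b φ γ a c = tridiagEntry b φ' γ' a c := by
  simp only [tridiagEntry, hφ c hc.le, hφ (c + 1) hc, hγ (c + 1) hc]

namespace CycleRun

open Asymptotics

variable {d : ℕ} {t : AMType} {m : ℕ} {τ η β₀ β₁ τ₀ μ L : ℝ} {N : ℕ}

local notation "𝓡" => CycleRun d t m τ η β₀ β₁ τ₀ μ L (N + 1)

local notation "𝓢" => small d t m τ η β₀ β₁ τ₀ μ L (N + 1)

local notation "𝓣" => smallPos d t m τ η β₀ β₁ τ₀ μ L (N + 1)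

/-- The entries of the tridiagonal matrix of the run. -/
noncomputable def entry {M : ℕ} (ω : CycleRun d t m τ η β₀ β₁ τ₀ μ L M) (a c : ℕ) : ℝ :=
  tridiagEntry (fun j => ω.β (ω.s + j)) (lastPhi ω.zeta ω.gam) (fun j => ω.gam j j) a c

/-- The entries of the tridiagonal matrix of the linearized process. -/
noncomputable def entry' {M : ℕ} (ω : CycleRun d t m τ η β₀ β₁ τ₀ μ L M) (a c : ℕ) : ℝ :=
  tridiagEntry (fun j => ω.β (ω.s + j))
    (lastPhi (fun i j => ω.ζ' (ω.s + i) j) (fun i j => ω.Γ' (ω.s + i) j))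
    (fun j => ω.Γ' (ω.s + j) j) a c

/-- The quadratic form of the weight at the directions of the linearized process. -/
noncomputable def D {M : ℕ} (ω : CycleRun d t m τ η β₀ β₁ τ₀ μ L M) (j : ℕ) : ℝ :=
  inner ℝ (ω.P j) (t.test ω.A (ω.A (ω.P j)))

theorem isBigO_gam_self (hτ : 0 < τ) (hβ₀ : 0 < β₀) (hμ : 0 < μ) {j : ℕ} (hj : j ≤ N) :
    (fun ω => ω.gam j j) =O[𝓣] fun _ => (1 : ℝ) :=
  (isBigO_gam hτ hβ₀ hμ (by omega) (isBigO_u hτ hβ₀ hμ (by omega))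
    (fun i h1 h2 => ⟨isBigO_p hτ hβ₀ hμ h1 (by omega), isBigO_q hτ hβ₀ hμ h1 (by omega)⟩)
    le_rfl).mono smallPos_le

theorem isBigO_zeta_last (hτ : 0 < τ) (hβ₀ : 0 < β₀) (hμ : 0 < μ) {j : ℕ} (hj : j ≤ N) :
    (fun ω => ω.zeta (j + 1) j) =O[𝓣] fun _ => (1 : ℝ) :=
  (isBigO_zeta hτ hβ₀ hμ (by omega) (fun i hi => isBigO_u hτ hβ₀ hμ (by omega))
    (fun i h1 h2 => ⟨isBigO_p hτ hβ₀ hμ h1 (by omega), isBigO_q hτ hβ₀ hμ h1 (by omega)⟩)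
    (Nat.lt_succ_self j)).mono smallPos_le

theorem isBigO_gam_self_sub (hτ : 0 < τ) (hβ₀ : 0 < β₀) (hμ : 0 < μ) (hτ₀ : 0 < τ₀) {j : ℕ}
    (hj : 1 ≤ j) (hj' : j ≤ N) :
    (fun ω => ω.gam j j - ω.Γ' (ω.s + j) j) =O[𝓣] fun ω => ω.e :=
  (close hτ hβ₀ hμ hτ₀ le_rfl).gam j hj (by omega) j hj le_rfl

theorem isBigO_zeta_last_sub (hτ : 0 < τ) (hβ₀ : 0 < β₀) (hμ : 0 < μ) (hτ₀ : 0 < τ₀) {j : ℕ}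
    (hj : 1 ≤ j) (hj' : j ≤ N) :
    (fun ω => ω.zeta (j + 1) j - ω.ζ' (ω.s + (j + 1)) j) =O[𝓣] fun ω => ω.e :=
  (close hτ hβ₀ hμ hτ₀ (by omega : j + 1 ≤ N + 1)).isBigO_zeta_sub hτ hβ₀ hμ hτ₀ (by omega) hj
    (by omega)

theorem isBigO_lastPhi (hτ : 0 < τ) (hβ₀ : 0 < β₀) (hμ : 0 < μ) {j : ℕ} (hj : j ≤ N) :
    (fun ω => lastPhi ω.zeta ω.gam j) =O[𝓣] fun _ => (1 : ℝ) := by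
  by_cases h0 : j = 0
  · simp only [lastPhi, if_pos h0]
    exact isBigO_zero _ _
  · simp only [lastPhi, if_neg h0]
    exact (isBigO_gam_self hτ hβ₀ hμ hj).add (isBigO_zeta_last hτ hβ₀ hμ hj)

theorem isBigO_lastPhi_sub (hτ : 0 < τ) (hβ₀ : 0 < β₀) (hμ : 0 < μ) (hτ₀ : 0 < τ₀) {j : ℕ}
    (hj : j ≤ N) :
    (fun ω => lastPhi ω.zeta ω.gam j -
      lastPhi (fun i j => ω.ζ' (ω.s + i) j) (fun i j => ω.Γ' (ω.s + i) j) j) =O[𝓣]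
      fun ω => ω.e := by
  by_cases h0 : j = 0
  · simp only [lastPhi, if_pos h0, sub_self]
    exact isBigO_zero _ _
  · simp only [lastPhi, if_neg h0]
    refine ((isBigO_gam_self_sub hτ hβ₀ hμ hτ₀ (by omega) hj).add
      (isBigO_zeta_last_sub hτ hβ₀ hμ hτ₀ (by omega) hj)).congr_left fun ω => ?_
    ring

theorem isBigO_inv_β (hβ₀ : 0 < β₀) (j : ℕ) :
    (fun ω => (ω.β (ω.s + j))⁻¹) =O[𝓣] fun _ => (1 : ℝ) := by
  refine IsBigO.of_bound β₀⁻¹ (Eventually.of_forall fun ω => ?_)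
  rw [norm_one, mul_one, norm_inv]
  exact inv_anti₀ hβ₀ (ω.mixing _).1

theorem isBigO_inv_gap (hτ₀ : 0 < τ₀) {j : ℕ} (hj : 1 ≤ j) (hj' : j ≤ N) :
    (fun ω => (1 - ω.gam j j)⁻¹) =O[𝓣] fun _ => (1 : ℝ) := by
  refine IsBigO.of_bound τ₀⁻¹ (Eventually.of_forall fun ω => ?_)
  rw [norm_one, mul_one, norm_inv]
  have h := ω.gap j hj (by omega)
  rw [ω.stamGamma_eq (by omega)] at h
  exact inv_anti₀ hτ₀ h

theorem isBigO_inv_gap_sub (hτ : 0 < τ) (hβ₀ : 0 < β₀) (hμ : 0 < μ) (hτ₀ : 0 < τ₀) {j : ℕ}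
    (hj : 1 ≤ j) (hj' : j ≤ N) :
    (fun ω => (1 - ω.gam j j)⁻¹ - (1 - ω.Γ' (ω.s + j) j)⁻¹) =O[𝓣] fun ω => ω.e := by
  have hsub := isBigO_gam_self_sub (d := d) (t := t) (m := m) (η := η) (β₁ := β₁) (L := L)
    hτ hβ₀ hμ hτ₀ hj hj'
  have hgap := eventually_ne_one hτ₀ hj (by omega) hsub
  have h1 : (fun ω => (1 - ω.Γ' (ω.s + j) j)⁻¹) =O[𝓣] fun _ => (1 : ℝ) := by
    refine IsBigO.of_bound (τ₀ / 2)⁻¹ ?_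
    filter_upwards [hgap] with ω h
    rw [norm_one, mul_one, norm_inv]
    exact inv_anti₀ (half_pos hτ₀) h
  have h2 := ((isBigO_inv_gap hτ₀ hj hj').mul h1).mul hsub
  refine h2.congr' ?_ (Eventually.of_forall fun ω => by ring)
  filter_upwards [hgap] with ω h
  have h3 : 1 - ω.Γ' (ω.s + j) j ≠ 0 := by
    intro h0
    rw [h0, abs_zero] at h
    linarith
  have h4 : 1 - ω.gam j j ≠ 0 := by
    have h5 := ω.gap j hj (by omega)
    rw [ω.stamGamma_eq (by omega)] at h5
    intro h0
    rw [h0, abs_zero] at h5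
    linarith
  field_simp
  ring

/-- Entries are polynomials in `φ`, `1 / β` and `1 / (1 - Γ)`: all are bounded, the first and last
change by `O(e)`, and `β` is common to both processes. -/
theorem isBigO_entry_sub (hτ : 0 < τ) (hβ₀ : 0 < β₀) (hμ : 0 < μ) (hτ₀ : 0 < τ₀) (a : ℕ) {c : ℕ}
    (hc : c < N) : (fun ω => ω.entry a c - ω.entry' a c) =O[𝓣] fun ω => ω.e := by
  have he : (fun ω : 𝓡 => ω.e) =O[𝓣] fun _ => (1 : ℝ) := isLittleO_e_pos.isBigO
  have hg := isBigO_inv_gap (d := d) (t := t) (m := m) (τ := τ) (η := η) (β₀ := β₀) (β₁ := β₁)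
    (μ := μ) (L := L) hτ₀ (by omega : 1 ≤ c + 1) hc
  have hg' := isBigO_inv_gap_sub (d := d) (t := t) (m := m) (η := η) (β₁ := β₁) (L := L)
    hτ hβ₀ hμ hτ₀ (by omega : 1 ≤ c + 1) hc
  have hφ : ∀ j ≤ N, (fun ω => lastPhi ω.zeta ω.gam j * (ω.β (ω.s + j))⁻¹) =O[𝓣]
      fun _ => (1 : ℝ) := fun j hj => by
    simpa using (isBigO_lastPhi hτ hβ₀ hμ hj).mul (isBigO_inv_β hβ₀ j)
  have hφ' : ∀ j ≤ N, (fun ω => lastPhi ω.zeta ω.gam j * (ω.β (ω.s + j))⁻¹ -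
      lastPhi (fun i j => ω.ζ' (ω.s + i) j) (fun i j => ω.Γ' (ω.s + i) j) j *
        (ω.β (ω.s + j))⁻¹) =O[𝓣] fun ω => ω.e := fun j hj => by
    have h := (isBigO_lastPhi_sub (d := d) (t := t) (m := m) (η := η) (β₁ := β₁) (L := L)
      hτ hβ₀ hμ hτ₀ hj).mul (isBigO_inv_β hβ₀ j)
    exact h.congr (fun ω => by ring) fun ω => by ring
  simp only [entry, entry', tridiagEntry]
  split_ifs with h1 h2 h3
  · exact (isBigO_mul_sub_mul he hg (hφ c hc.le) hg' (hφ' c hc.le)).congr_left fun ω => by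
      simp only [div_eq_mul_inv, mul_inv]
      ring
  · refine (isBigO_mul_sub_mul he hg ((isBigO_inv_β hβ₀ c).sub (hφ (c + 1) hc)) hg'
      (x' := fun ω => (ω.β (ω.s + c))⁻¹ - lastPhi (fun i j => ω.ζ' (ω.s + i) j)
        (fun i j => ω.Γ' (ω.s + i) j) (c + 1) * (ω.β (ω.s + (c + 1)))⁻¹) ?_).congr_left
      fun ω => ?_
    · exact (hφ' (c + 1) hc).neg_left.congr_left fun ω => by ring
    · simp only [div_eq_mul_inv, one_mul]
  · exact ((isBigO_inv_β hβ₀ (c + 1)).mul hg').neg_left.congr (fun ω => by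
      simp only [div_eq_mul_inv, mul_inv, one_mul]
      ring) fun ω => by ring
  · simp only [sub_self]
    exact isBigO_zero _ _

theorem isBigO_D (hτ : 0 < τ) (hβ₀ : 0 < β₀) (hμ : 0 < μ) (hτ₀ : 0 < τ₀) {j : ℕ} (hj : 1 ≤ j)
    (hj' : j ≤ N) : (fun ω => ω.D j) =O[𝓣] fun ω => ω.ε * ω.ε := by
  have hle : 𝓣 ≤ 𝓢 := smallPos_le
  have hc := close (d := d) (t := t) (m := m) (η := η) (β₁ := β₁) (L := L)
    hτ hβ₀ hμ hτ₀ (le_refl (N + 1))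
  have hP : (fun ω => ω.P j) =O[𝓣] fun ω => ω.ε :=
    ((isBigO_p hτ hβ₀ hμ hj (by omega)).mono hle).of_sub_left isLittleO_e_pos.isBigO
      (hc.p j hj (by omega))
  refine hP.real_inner ?_
  cases t
  · exact isBigO_A hP
  · exact isBigO_A (isBigO_A hP)

theorem isBigO_D_inv (hτ : 0 < τ) (hβ₀ : 0 < β₀) (hμ : 0 < μ) (hτ₀ : 0 < τ₀) {j : ℕ} (hj : 1 ≤ j)
    (hj' : j ≤ N) : (fun ω => ω.ε * ω.ε) =O[𝓣] fun ω => ω.D j := by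
  have hc := close (d := d) (t := t) (m := m) (η := η) (β₁ := β₁) (L := L)
    hτ hβ₀ hμ hτ₀ (le_refl (N + 1))
  exact isBigO_form hτ hβ₀ hμ hj (by omega) (hc.p j hj (by omega)) (hc.q j hj (by omega))

/-- All `D_j` are of exact order `ε²`, so the ratios stay bounded and the symmetrization costs only
a constant, although the directions themselves shrink with `ε`. -/
theorem isBigO_weighted_entry_sub (hτ : 0 < τ) (hβ₀ : 0 < β₀) (hμ : 0 < μ) (hτ₀ : 0 < τ₀) :
    (fun ω => ∑ a : Fin N, ∑ c : Fin N, √(ω.D (a + 1) / ω.D (c + 1)) *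
      |ω.entry a c - ω.entry' a c|) =O[𝓣] fun ω => ω.e := by
  refine IsBigO.fun_sum fun a _ => IsBigO.fun_sum fun c _ => ?_
  have h1 : (fun ω => ω.D (a + 1) / ω.D (c + 1)) =O[𝓣] fun _ => (1 : ℝ) := by
    refine IsBigO.div_of_mul ?_
    simpa using (isBigO_D hτ hβ₀ hμ hτ₀ (by omega) a.2).trans
      (isBigO_D_inv hτ hβ₀ hμ hτ₀ (by omega) c.2)
  have h2 : (fun ω => √(ω.D (a + 1) / ω.D (c + 1))) =O[𝓣] fun _ => (1 : ℝ) := by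
    refine IsBigO.trans (isBigO_of_le _ fun ω => ?_)
      ((isBigO_refl (fun _ => (1 : ℝ)) _).add h1.norm_left)
    rw [Real.norm_of_nonneg (Real.sqrt_nonneg _), Real.norm_of_nonneg (by positivity),
      Real.sqrt_le_iff]
    refine ⟨by positivity, (Real.le_norm_self _).trans ?_⟩
    nlinarith [norm_nonneg (ω.D (a + 1) / ω.D (c + 1))]
  simpa using h2.mul (isBigO_entry_sub hτ hβ₀ hμ hτ₀ a c.2).norm_left

theorem eventually_lanczos (hτ : 0 < τ) (hβ₀ : 0 < β₀) (hμ : 0 < μ) (hτ₀ : 0 < τ₀) :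
    ∀ᶠ ω in 𝓣, IsLanczosMatrix (t.weight ω.A) ω.A (-ω.A (ω.U 0))
      (fun i : Fin N => ω.P ((i : ℕ) + 1)) (Matrix.of fun a c : Fin N => ω.entry' a c) := by
  have hc := close (d := d) (t := t) (m := m) (η := η) (β₁ := β₁) (L := L)
    hτ hβ₀ hμ hτ₀ (le_refl (N + 1))
  have h1 : ∀ᶠ ω in 𝓣, ∀ j ∈ Finset.Icc 1 N,
      0 < (inner ℝ (ω.P j) (t.test ω.A (ω.A (ω.P j))) : ℝ) := by
    rw [Filter.eventually_all_finset]
    intro j hj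
    obtain ⟨h2, h3⟩ := Finset.mem_Icc.1 hj
    exact eventually_form_pos hτ hβ₀ hμ h2 (by omega) (hc.p j h2 (by omega)) (hc.q j h2 (by omega))
  have h2 : ∀ᶠ ω in 𝓣, ∀ j ∈ Finset.Icc 1 N, ω.Γ' (ω.s + j) j ≠ 1 := by
    rw [Filter.eventually_all_finset]
    intro j hj
    obtain ⟨h2, h3⟩ := Finset.mem_Icc.1 hj
    exact hc.eventually_gam_ne hτ₀ le_rfl h2 (by omega)
  filter_upwards [h1, h2] with ω h3 h4
  exact ω.linearCycle.isLanczosMatrix (t.weight_apply ω.A) (fun j => ω.β_ne_zero hβ₀ _) h3 h4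

/-- Perturbation bound for the eigenvalues of the tridiagonal matrix of a cycle. -/
theorem eventually_spectrum (hτ : 0 < τ) (hβ₀ : 0 < β₀) (hμ : 0 < μ) (hτ₀ : 0 < τ₀) :
    ∃ C : ℝ, 0 < C ∧ ∀ᶠ ω in 𝓣, ∀ lam ∈ spectrum ℂ
      ((Matrix.of fun a c : Fin N => ω.entry a c).map (algebraMap ℝ ℂ)),
      ∃ lam' ∈ spectrum ℂ ((Matrix.of fun a c : Fin N => ω.entry' a c).map (algebraMap ℝ ℂ)),
        ‖lam' - lam‖ ≤ C * ω.e := by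
  obtain ⟨C, hC, hb⟩ := (isBigO_weighted_entry_sub (d := d) (t := t) (m := m) (η := η) (β₁ := β₁)
    (L := L) (N := N) hτ hβ₀ hμ hτ₀).exists_pos
  refine ⟨C, hC, ?_⟩
  filter_upwards [hb.bound, eventually_lanczos hτ hβ₀ hμ hτ₀] with ω h1 h2 lam hlam
  rw [Real.norm_of_nonneg ω.e_nonneg] at h1
  refine Matrix.exists_spectrum_near _ _ (fun j : Fin N => ω.D (j + 1)) (fun i => ?_)
    (fun i j => ?_) _ ((Real.le_norm_self _).trans h1) lam hlam
  · have := h2.pos i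
    rwa [t.weight_apply] at this
  · have hproj : ∀ i j : Fin N, inner ℝ (ω.P (i + 1)) (t.weight ω.A (ω.A (ω.P (j + 1)))) =
        ω.D (i + 1) * ω.entry' i j := by
      intro i j
      have h3 := h2.projection i j
      rw [Finset.sum_eq_single_of_mem i (Finset.mem_univ i), t.weight_apply (y := ω.P (i + 1))]
        at h3
      · exact h3
      · intro b _ hb
        rw [h2.orth i b (Ne.symm hb), zero_mul]
    have h3 := ω.linearCycle.form_symm (ω.P (i + 1)) (ω.A (ω.P (j + 1)))
    have h4 := hproj i j
    have h5 := hproj j i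
    rw [t.weight_apply] at h4 h5
    rw [← h4, ← h5, h3, ω.symm_A]
    congr 1
    exact (ω.linearCycle.comm _).symm

end CycleRun

/-! ### From filters to uniform constants. -/

namespace CycleRun

open Asymptotics

variable {d : ℕ} {t : AMType} {m : ℕ} {τ η β₀ β₁ τ₀ μ L : ℝ}

theorem exists_of_eventually_small {M : ℕ}
    {p : CycleRun d t m τ η β₀ β₁ τ₀ μ L M → Prop}
    (h : ∀ᶠ ω in small d t m τ η β₀ β₁ τ₀ μ L M, p ω) :
    ∃ c : ℝ, 0 < c ∧ ∀ ω : CycleRun d t m τ η β₀ β₁ τ₀ μ L M, ω.e + ω.ε / ω.ρ < c → p ω := by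
  rw [small, eventually_comap] at h
  obtain ⟨c, hc, hb⟩ := Metric.eventually_nhds_iff.1 h
  refine ⟨c, hc, fun ω hω => hb ?_ ω rfl⟩
  rw [Real.dist_0_eq_abs, abs_of_nonneg (add_nonneg ω.e_nonneg ω.ratio_nonneg)]
  exact hω

theorem exists_of_eventually_smallPos {M : ℕ}
    {p : CycleRun d t m τ η β₀ β₁ τ₀ μ L M → Prop}
    (h : ∀ᶠ ω in smallPos d t m τ η β₀ β₁ τ₀ μ L M, p ω) :
    ∃ c : ℝ, 0 < c ∧ ∀ ω : CycleRun d t m τ η β₀ β₁ τ₀ μ L M,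
      ω.e + ω.ε / ω.ρ < c → ω.ε ≠ 0 → p ω := by
  rw [smallPos, eventually_inf_principal] at h
  exact exists_of_eventually_small h

/-- Constants for finitely many cycle lengths can be chosen uniformly. -/
theorem exists_uniform_constants (m : ℕ) (Q : ℕ → ℝ → ℝ → Prop)
    (hmono : ∀ M C C' c c', C ≤ C' → c' ≤ c → Q M C c → Q M C' c')
    (h : ∀ M, ∃ C c : ℝ, 0 < c ∧ Q M C c) :
    ∃ C c : ℝ, 1 ≤ C ∧ 0 < c ∧ ∀ M ≤ m, Q M C c := by
  induction m with
  | zero =>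
    obtain ⟨C, c, hc, hQ⟩ := h 0
    refine ⟨max 1 C, c, le_max_left _ _, hc, fun M hM => ?_⟩
    obtain rfl : M = 0 := by omega
    exact hmono _ _ _ _ _ (le_max_right _ _) le_rfl hQ
  | succ m ih =>
    obtain ⟨C, c, hC, hc, hQ⟩ := ih
    obtain ⟨C', c', hc', hQ'⟩ := h (m + 1)
    refine ⟨max C C', min c c', hC.trans (le_max_left _ _), lt_min hc hc', fun M hM => ?_⟩
    rcases hM.lt_or_eq with h1 | rfl
    · exact hmono _ _ _ _ _ (le_max_left _ _) (min_le_left _ _) (hQ M (by omega))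
    · exact hmono _ _ _ _ _ (le_max_right _ _) (min_le_right _ _) hQ'

/-- The iterates of a cycle and its successor stay near the solution. -/
theorem exists_norm_u_le (d : ℕ) (t : AMType) (m : ℕ) (η β₁ τ₀ L : ℝ) (hτ : 0 < τ) (hβ₀ : 0 < β₀)
    (hμ : 0 < μ) : ∃ C c : ℝ, 1 ≤ C ∧ 0 < c ∧ ∀ M ≤ m,
      ∀ ω : CycleRun d t m τ η β₀ β₁ τ₀ μ L M, ω.e + ω.ε / ω.ρ < c →
        ‖ω.u (M + 1)‖ ≤ C * ω.ε := by
  refine exists_uniform_constants m (fun M C c => ∀ ω : CycleRun d t m τ η β₀ β₁ τ₀ μ L M,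
    ω.e + ω.ε / ω.ρ < c → ‖ω.u (M + 1)‖ ≤ C * ω.ε) ?_ ?_
  · intro M C C' c c' hC hc h ω hω
    exact (h ω (hω.trans_le hc)).trans (mul_le_mul_of_nonneg_right hC ω.ε_nonneg)
  · intro M
    obtain ⟨C, hC⟩ := (isBigO_u (d := d) (t := t) (m := m) (η := η) (β₁ := β₁) (τ₀ := τ₀) (L := L)
      (M := M) hτ hβ₀ hμ le_rfl).bound
    obtain ⟨c, hc, h⟩ := exists_of_eventually_small hC
    refine ⟨C, c, hc, fun ω hω => ?_⟩
    have := h ω hω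
    rwa [Real.norm_of_nonneg ω.ε_nonneg] at this

/-- Since `ρ` and `κ` are fields of `ω`, the constants are chosen before them. The cycle has one
step more than the matrix has columns, because the last column involves `ζ` of the following
iteration. -/
theorem exists_spectrum_lanczos (d : ℕ) (t : AMType) (m : ℕ) (η β₁ L : ℝ) (hτ : 0 < τ)
    (hβ₀ : 0 < β₀) (hμ : 0 < μ) (hτ₀ : 0 < τ₀) : ∃ C c : ℝ, 1 ≤ C ∧ 0 < c ∧ ∀ N ≤ m,
      ∀ ω : CycleRun d t m τ η β₀ β₁ τ₀ μ L (N + 1), ω.e + ω.ε / ω.ρ < c → ω.ε ≠ 0 →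
        (∀ lam ∈ spectrum ℂ ((Matrix.of fun a c : Fin N => ω.entry a c).map (algebraMap ℝ ℂ)),
          ∃ lam' ∈ spectrum ℂ
              ((Matrix.of fun a c : Fin N => ω.entry' a c).map (algebraMap ℝ ℂ)),
            ‖lam' - lam‖ ≤ C * ω.e) ∧
        IsLanczosMatrix (t.weight ω.A) ω.A (-ω.A (ω.U 0))
          (fun i : Fin N => ω.P ((i : ℕ) + 1)) (Matrix.of fun a c : Fin N => ω.entry' a c) := by
  refine exists_uniform_constants m (fun N C c =>
      ∀ ω : CycleRun d t m τ η β₀ β₁ τ₀ μ L (N + 1), ω.e + ω.ε / ω.ρ < c → ω.ε ≠ 0 →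
        (∀ lam ∈ spectrum ℂ ((Matrix.of fun a c : Fin N => ω.entry a c).map (algebraMap ℝ ℂ)),
          ∃ lam' ∈ spectrum ℂ
              ((Matrix.of fun a c : Fin N => ω.entry' a c).map (algebraMap ℝ ℂ)),
            ‖lam' - lam‖ ≤ C * ω.e) ∧
        IsLanczosMatrix (t.weight ω.A) ω.A (-ω.A (ω.U 0))
          (fun i : Fin N => ω.P ((i : ℕ) + 1))
          (Matrix.of fun a c : Fin N => ω.entry' a c)) ?_ ?_
  · intro N C C' c c' hC hc h ω hω hε
    obtain ⟨h1, h2⟩ := h ω (hω.trans_le hc) hε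
    refine ⟨fun lam hlam => ?_, h2⟩
    obtain ⟨lam', h3, h4⟩ := h1 lam hlam
    exact ⟨lam', h3, h4.trans (mul_le_mul_of_nonneg_right hC ω.e_nonneg)⟩
  · intro N
    obtain ⟨C, hC, h⟩ := eventually_spectrum (d := d) (t := t) (m := m) (η := η) (β₁ := β₁)
      (L := L) (N := N) hτ hβ₀ hμ hτ₀
    obtain ⟨c, hc, h⟩ := exists_of_eventually_smallPos
      (h.and (eventually_lanczos hτ hβ₀ hμ hτ₀))
    exact ⟨C, c, hc, fun ω hω hε => h ω hω hε⟩

end CycleRun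

/-! ### Memory sizes along a run. -/

namespace IsRestartedSTAM

variable {d : ℕ} {t : AMType} {g : EuclideanSpace ℝ (Fin d) → EuclideanSpace ℝ (Fin d)}
  {β : ℕ → ℝ} {m : ℕ} {τ η : ℝ} {x p q : ℕ → EuclideanSpace ℝ (Fin d)} {n : ℕ → ℕ}

theorem mem_cases (h : IsRestartedSTAM t g β m τ η x p q n) (k : ℕ) :
    n k = 0 ∨ (n k = enterMem n k ∧ enterMem n k ≤ m) := by
  classical
  have h1 := h.mem k
  split_ifs at h1 with h2 h3
  · exact Or.inl h1
  · exact Or.inl h1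
  · refine Or.inr ⟨h1, ?_⟩
    rw [RestartTest, not_or] at h2
    omega

theorem mem_le (h : IsRestartedSTAM t g β m τ η x p q n) (k : ℕ) : n k ≤ m := by
  rcases h.mem_cases k with h1 | h1 <;> omega

theorem mem_succ (h : IsRestartedSTAM t g β m τ η x p q n) {k : ℕ} (hk : n (k + 1) ≠ 0) :
    n (k + 1) = n k + 1 := by
  rcases h.mem_cases (k + 1) with h1 | h1
  · exact absurd h1 hk
  · exact h1.1

/-- The memory either resets or grows by one, so it counts the steps since the last restart. This
splits a run into cycles. -/
theorem mem_cycle (h : IsRestartedSTAM t g β m τ η x p q n) (k : ℕ) :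
    n k ≤ k ∧ ∀ i ≤ n k, n (k - n k + i) = i := by
  induction k with
  | zero =>
    have h0 : n 0 = 0 := by
      rcases h.mem_cases 0 with h1 | h1
      · exact h1
      · exact h1.1
    refine ⟨h0.le, fun i hi => ?_⟩
    obtain rfl : i = 0 := by omega
    simpa using h0
  | succ k ih =>
    by_cases hk : n (k + 1) = 0
    · refine ⟨by omega, fun i hi => ?_⟩
      obtain rfl : i = 0 := by omega
      simp [hk]
    · have h1 := h.mem_succ hk
      refine ⟨by omega, fun i hi => ?_⟩
      have h2 : k + 1 - n (k + 1) = k - n k := by omega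
      rw [h2]
      rcases hi.lt_or_eq with h3 | h3
      · exact ih.2 i (by omega)
      · have h4 : k - n k + i = k + 1 := by omega
        rw [h4, h3]

end IsRestartedSTAM

/-! ### Assembly: all cycles start near the solution. -/

theorem theorem6p2 (d : ℕ) (t : AMType) (m : ℕ) (hm : 0 < m)
    (τ η β₀ β₁ η₀ τ₀ μ L : ℝ) (hτ : 0 < τ) (hτ' : τ < 1) (hη : 0 < η)
    (hβ₀ : 0 < β₀) (hβ₁ : 0 < β₁) (hη₀ : 0 < η₀) (hτ₀ : 0 < τ₀) (hμ : 0 < μ) (hL : 0 < L) :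
    ∃ C : ℝ, 0 < C ∧ ∀ ρ κ : ℝ, 0 < ρ → 0 < κ → ∃ δ : ℝ, 0 < δ ∧
      ∀ (g : EuclideanSpace ℝ (Fin d) → EuclideanSpace ℝ (Fin d))
        (xs : EuclideanSpace ℝ (Fin d)),
        RegularFixedPoint g xs →
        LocalConstants (fpDefect g) xs ρ κ μ L →
        (∀ᶠ z in 𝓝 xs, (fderiv ℝ g z).toLinearMap.IsSymmetric) →
      ∀ β : ℕ → ℝ, (∀ k, β₀ ≤ |β k| ∧ |β k| ≤ β₁) →
      ∀ (x p q : ℕ → EuclideanSpace ℝ (Fin d)) (n : ℕ → ℕ),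
        IsRestartedSTAM t g β m τ η x p q n →
      ∀ (x' p' q' : ℕ → EuclideanSpace ℝ (Fin d)) (ζ' Γ' : ℕ → ℕ → ℝ),
        IsLinearizedAM t (fderiv ℝ (fpDefect g) xs) xs β x n x' p' q' ζ' Γ' →
      ‖x 0 - xs‖ ≤ δ →
      ∀ k : ℕ, 2 ≤ n (k + 1) →
        fpDefect g (x (k - n k)) ≠ 0 →
        (∀ j ≤ k + 1, ‖fpDefect g (x j)‖ ≤ η₀ * ‖fpDefect g (x 0)‖) →
        (∀ j, 1 ≤ j → j ≤ k → n j ≠ 0 → τ₀ ≤ |1 - stamGamma t g x p q n j (n j)|) →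
        (∀ lam ∈ spectrum ℂ
            ((amTridiag β n (stamZeta t g x p q n) (stamGamma t g x p q n) k).map
              (algebraMap ℝ ℂ)),
          ∃ lam' ∈ spectrum ℂ ((amTridiag β n ζ' Γ' k).map (algebraMap ℝ ℂ)),
            ‖lam' - lam‖ ≤ κ * (C * ‖x (k - n k) - xs‖)) ∧
        IsLanczosMatrix (t.weight (fderiv ℝ (fpDefect g) xs)) (fderiv ℝ (fpDefect g) xs)
          (-(fderiv ℝ (fpDefect g) xs (x' (k - n k) - xs)))
          (fun i : Fin (n k) => p' (k - n k + 1 + (i : ℕ)))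
          (amTridiag β n ζ' Γ' k) := by
  obtain ⟨Cb, cb, hCb, hcb, hball⟩ :=
    CycleRun.exists_norm_u_le (τ := τ) (β₀ := β₀) (μ := μ) d t m η β₁ τ₀ L hτ hβ₀ hμ
  obtain ⟨C, c, hC, hc, hmain⟩ :=
    CycleRun.exists_spectrum_lanczos (τ := τ) (β₀ := β₀) (μ := μ) (τ₀ := τ₀) d t m η β₁ L
      hτ hβ₀ hμ hτ₀
  refine ⟨C, by linarith, fun ρ κ hρ hκ => ?_⟩
  -- For a cycle started within `R`, the bounds on cycles apply; the next iterate stays in the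
  -- `ρ`-ball, where at distance `Cb * R` the nonlinear part of the residual is at most half of the
  -- linear part.
  obtain ⟨R, hR, hR1, hR2, hR3⟩ : ∃ R : ℝ, 0 < R ∧ κ * R + R / ρ < min cb c ∧ Cb * R ≤ ρ ∧
      κ * (Cb * R) ≤ μ := by
    have hc0 : 0 < min cb c := lt_min hcb hc
    have hlim : ∀ a : ℝ, Tendsto (fun R : ℝ => a * R) (𝓝[>] 0) (𝓝 0) := fun a => by
      have : Tendsto (fun R : ℝ => a * R) (𝓝 0) (𝓝 (a * 0)) := tendsto_id.const_mul a
      rw [mul_zero] at this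
      exact this.mono_left nhdsWithin_le_nhds
    have h1 := (hlim (κ + 1 / ρ)).eventually_lt_const hc0
    have h2 := (hlim Cb).eventually_lt_const hρ
    have h3 := (hlim (κ * Cb)).eventually_lt_const hμ
    obtain ⟨R, ⟨h4, h5, h6⟩, h7⟩ := ((h1.and (h2.and h3)).and self_mem_nhdsWithin).exists
    refine ⟨R, h7, ?_, h5.le, ?_⟩
    · calc κ * R + R / ρ = (κ + 1 / ρ) * R := by ring
        _ < _ := h4
    · rw [← mul_assoc]
      exact h6.le
  -- `W - 1` bounds the growth of the error from the start of the run when residuals grow at most by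
  -- `η₀`: `2 / μ` converts residual to error, `L + μ` error to residual.
  set W : ℝ := 1 + 2 / μ * η₀ * (L + μ) with hW
  have hW1 : 1 ≤ W := by
    rw [hW]
    have : 0 < 2 / μ * η₀ * (L + μ) := by positivity
    linarith
  refine ⟨R / W, by positivity, ?_⟩
  intro g xs hreg hloc hsymm β hβ x p q n hrun x' p' q' ζ' Γ' hlin hx0 k hk hr hη' hgap
  have hδR : R / W ≤ R := div_le_self hR.le hW1
  have hCbR : R ≤ Cb * R := le_mul_of_one_le_left hR.le hCb
  have hxs : xs ∈ Metric.closedBall xs ρ := Metric.mem_closedBall_self hρ.le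
  -- The part of the run from the last restart before iteration `j`.
  let run : ∀ (j M : ℕ), (∀ i ≤ M, n (j + i) = i) → j + M ≤ k + 1 →
      CycleRun d t m τ η β₀ β₁ τ₀ μ L M := fun j M hM hj =>
    { g := g, xs := xs, ρ := ρ, κ := κ, β := β, x := x, p := p, q := q, n := n, x' := x', p' := p'
      q' := q', ζ' := ζ', Γ' := Γ', s := j, ρ_pos := hρ, κ_pos := hκ
      loc := hloc, symm := hsymm.self_of_nhds, mixing := hβ, run := hrun, lin := hlin, mem := hM
      gap := fun i h1 h2 => by
        have h3 := hgap (j + i) (by omega) (by omega) (by rw [hM i h2.le]; omega)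
        rwa [hM i h2.le] at h3 }
  -- The cycle bound alone would compound `Cb` over the cycles. It serves only to place the new
  -- iterate in the ball where residual and error are comparable; the residual bound relative to `x
  -- 0` then restores the radius `R`.
  have hnear : ∀ j ≤ k + 1, ‖x j - xs‖ ≤ R := by
    intro j
    induction j using Nat.strong_induction_on with
    | _ j ih =>
      intro hj
      rcases Nat.eq_zero_or_pos j with rfl | hpos
      · exact hx0.trans hδR
      · obtain ⟨j, rfl⟩ : ∃ j', j = j' + 1 := ⟨j - 1, by omega⟩
        obtain ⟨h1, h2⟩ := hrun.mem_cycle j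
        let ω := run (j - n j) (n j) h2 (by omega)
        have hε : ω.ε ≤ R := ih (j - n j) (by omega) (by omega)
        have hsmall : ω.e + ω.ε / ω.ρ < cb := by
          refine lt_of_le_of_lt ?_ (hR1.trans_le (min_le_left _ _))
          exact add_le_add (mul_le_mul_of_nonneg_left hε hκ.le)
            (div_le_div_of_nonneg_right hε hρ.le)
        have hu := hball (n j) (hrun.mem_le j) ω hsmall
        have hx : ω.u (n j + 1) = x (j + 1) - xs := by
          change x (j - n j + (n j + 1)) - xs = _
          rw [show j - n j + (n j + 1) = j + 1 by omega]
        rw [hx] at hu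
        have hu' : ‖x (j + 1) - xs‖ ≤ Cb * R :=
          hu.trans (mul_le_mul_of_nonneg_left hε (by linarith))
        have hl1 := hloc.linearization (x (j + 1)) (mem_closedBall_iff_norm.2 (hu'.trans hR2))
        have hl0 := hloc.linearization (x 0)
          (mem_closedBall_iff_norm.2 (hx0.trans (hδR.trans (hCbR.trans hR2))))
        have ha1 := (hloc.jacobian xs hxs (x (j + 1) - xs)).1
        have ha0 := (hloc.jacobian xs hxs (x 0 - xs)).2
        have hn1 := norm_sub_norm_le (fderiv ℝ (fpDefect g) xs (x (j + 1) - xs))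
          (fpDefect g (x (j + 1)))
        rw [norm_sub_rev] at hn1
        have hn0 := norm_sub_norm_le (fpDefect g (x 0)) (fderiv ℝ (fpDefect g) xs (x 0 - xs))
        have hη1 := hη' (j + 1) hj
        have hsq : ∀ y : EuclideanSpace ℝ (Fin d), ‖y‖ ≤ Cb * R →
            κ * ‖y‖ ^ 2 ≤ μ * ‖y‖ := by
          intro y hy
          have : κ * ‖y‖ ≤ μ := (mul_le_mul_of_nonneg_left hy hκ.le).trans hR3
          calc κ * ‖y‖ ^ 2 = κ * ‖y‖ * ‖y‖ := by ring
            _ ≤ μ * ‖y‖ := mul_le_mul_of_nonneg_right this (norm_nonneg _)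
        have hs1 := hsq _ hu'
        have hs0 := hsq _ (hx0.trans (hδR.trans hCbR))
        have hh0 : ‖fpDefect g (x 0)‖ ≤ (L + μ) * (R / W) := by
          have : ‖fpDefect g (x 0)‖ ≤ (L + μ) * ‖x 0 - xs‖ := by
            nlinarith [norm_nonneg (x 0 - xs)]
          exact this.trans (mul_le_mul_of_nonneg_left hx0 (by positivity))
        have hh1 : ‖x (j + 1) - xs‖ ≤ 2 / μ * ‖fpDefect g (x (j + 1))‖ := by
          rw [div_mul_eq_mul_div, le_div_iff₀ hμ]
          linarith
        calc ‖x (j + 1) - xs‖ ≤ 2 / μ * ‖fpDefect g (x (j + 1))‖ := hh1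
          _ ≤ 2 / μ * (η₀ * ((L + μ) * (R / W))) := by
              refine mul_le_mul_of_nonneg_left (hη1.trans ?_) (by positivity)
              exact mul_le_mul_of_nonneg_left hh0 hη₀.le
          _ = (W - 1) * (R / W) := by rw [hW]; ring
          _ ≤ W * (R / W) := mul_le_mul_of_nonneg_right (by linarith) (by positivity)
          _ = R := mul_div_cancel₀ R (by linarith)
  have hk1 : n (k + 1) = n k + 1 := hrun.mem_succ (by omega)
  obtain ⟨hkk, hcyc⟩ := hrun.mem_cycle (k + 1)
  have hs : k + 1 - n (k + 1) = k - n k := by omega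
  rw [hs, hk1] at hcyc
  -- The cycle is taken up to iteration `k + 1`, which supplies `ζ_{k+1}`; its gap condition
  -- concerns only iterations up to `k`.
  let ω := run (k - n k) (n k + 1) hcyc (by omega)
  have hε : ω.ε ≤ R := hnear (k - n k) (by omega)
  have hε0 : ω.ε ≠ 0 := by
    intro h0
    have h1 : x (k - n k) = xs := sub_eq_zero.1 (norm_eq_zero.1 h0)
    exact hr (by rw [h1, hreg.zero])
  have hsmall : ω.e + ω.ε / ω.ρ < c := by
    refine lt_of_le_of_lt ?_ (hR1.trans_le (min_le_right _ _))
    exact add_le_add (mul_le_mul_of_nonneg_left hε hκ.le) (div_le_div_of_nonneg_right hε hρ.le)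
  obtain ⟨h1, h2⟩ := hmain (n k) (hrun.mem_le k) ω hsmall hε0
  have hT : amTridiag β n (stamZeta t g x p q n) (stamGamma t g x p q n) k =
      Matrix.of fun a c : Fin (n k) => ω.entry a c := by
    ext a b
    rw [amTridiag_apply]
    refine tridiagEntry_congr (φ' := lastPhi ω.zeta ω.gam) (γ' := fun j => ω.gam j j) b.2
      (fun j hj => ?_) fun j hj => ?_
    · simp only [amPhi, lastPhi]
      rw [hcyc j (by omega)]
      refine if_congr Iff.rfl rfl ?_
      exact congrArg₂ (· + ·) (ω.stamGamma_eq (by omega) j)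
        (ω.stamZeta_eq (i := j + 1) (by omega) (by omega) j)
    · rw [hcyc j (by omega)]
      exact ω.stamGamma_eq (by omega) j
  have hT' : amTridiag β n ζ' Γ' k = Matrix.of fun a c : Fin (n k) => ω.entry' a c := by
    ext a b
    rw [amTridiag_apply]
    refine tridiagEntry_congr
      (φ' := lastPhi (fun i j => ω.ζ' (ω.s + i) j) (fun i j => ω.Γ' (ω.s + i) j))
      (γ' := fun j => ω.Γ' (ω.s + j) j) b.2 (fun j hj => ?_) fun j hj => ?_
    · simp only [amPhi, lastPhi]
      rw [hcyc j (by omega)]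
      rfl
    · rw [hcyc j (by omega)]
  have hp : (fun i : Fin (n k) => p' (k - n k + 1 + (i : ℕ))) =
      fun i : Fin (n k) => ω.P ((i : ℕ) + 1) := by
    funext i
    change _ = p' (k - n k + ((i : ℕ) + 1))
    rw [show k - n k + 1 + (i : ℕ) = k - n k + ((i : ℕ) + 1) by omega]
  rw [hT, hT', hp]
  refine ⟨fun lam hlam => ?_, h2⟩
  obtain ⟨lam', h3, h4⟩ := h1 lam hlam
  refine ⟨lam', h3, h4.trans (le_of_eq ?_)⟩
  change C * (κ * ‖x (k - n k + 0) - xs‖) = _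
  rw [add_zero]
  ring
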